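/- **Setting.** Let $X$ be an $m$-manifold with corners: a second countable Hausdorff space with a maximal atlas of charts $(U,\phi)$, where $U\subseteq\mathbb R^m_k=[0,\infty)^k\times\mathbb R^{m-k}$ is open, $0\le k\le m$, and $\phi:U\to X$ is a homeomorphism onto an open set; changes of charts are diffeomorphisms (smooth up to the boundary, each $[0,\infty)$-valued component being locally a positive smooth function times a monomial in the boundary coordinates). Let $X^\circ$ be its interior and $\partial X$ its boundary (pairs of a point $x\in X$ and a local boundary component at $x$), with connected components $\partial_iX$. *A-smooth functions.* For $U\subseteq\mathbb R^m_k$ open and $f:U\to\mathbb R$, the b-derivatives of $f$ are ${}^b\partial_if=x_i\frac{\partial f}{\partial x_i}$ for $i\le k$, taken to be $0$ where $x_i=0$ (no derivative is required to exist there), and ${}^b\partial_if=\frac{\partial f}{\partial x_i}$ for $i>k$. The function $f$ is *a-smooth* if all iterated b-derivatives of $f$ exist and are continuous on $U$, and for every iterated b-derivative $h$ (including $h=f$), every $i\le k$ and every compact $S\subseteq U$ there are $C,\alpha>0$ with $|{}^b\partial_ih|\le Cx_i^\alpha$ on $S$. A map $(f_1,\dots,f_m)$ between open sets of $\mathbb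 R^m_k$ and $\mathbb R^m_l$ is a-smooth if it is continuous, $f_j$ is a-smooth for $j>l$, and, near each point $u$, $f_j$ for $j\le l$ is either $0$ or of the form $F\cdot\prod_{i\le k}x_i^{a_i}$ with $F>0$ a-smooth and real $a_i\ge0$, where $a_i=0$ if $u_i\neq0$. Let $\tilde X$ be the manifold with a-corners with the same underlying space as $X$ whose a-charts are all $(U,\phi)$ as above such that the changes of coordinates to and from every chart of $X$ are a-smooth. The charts of $X$ are a-charts of $\tilde X$, and $\tilde X^\circ=X^\circ$. *Weights and $L_\lambda$.* A weight $\lambda\in W(\tilde X)$ assigns a real number $\lambda_i$ to each face $\{x_i=0\}$, $i\le k$, of each a-chart with connected faces, with $\lambda_i=0$ for empty faces, such that if $\tilde x_j=F_j\prod_ix_i^{a_{i,j}}$ is a change of coordinates near a point with $x_i=0$, then $\lambda_i=\sum_ja_{i,j}\tilde\lambda_j$. In charts of $X$, $\lambda$ is thus a locally constant function on $\partial X$. The real line bundle $L_\lambda\to\tilde X$ has a basis section $e_{U,\phi}$ over $\phi(U)$ for each such a-chart $(U,\phi)$. Two of them are related by $e_{\tilde U,\tilde\phi}=\tilde x_1^{\tilde\lambda_1}\cdots\tilde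 x_l^{\tilde\lambda_l}\,x_1^{-\lambda_1}\cdots x_k^{-\lambda_k}\,e_{U,\phi}$, where the factor is extended continuously from the interior. A section is a-smooth if near each point it is $f\,e_{U,\phi}$ with $f$ an a-smooth function in the chart. Over $X^\circ$, $L_\lambda$ is identified with the trivial line bundle by $e_{U,\phi}\mapsto x_1^{\lambda_1}\cdots x_k^{\lambda_k}$. Write $\Gamma^\infty(L_\lambda)$ for the space of a-smooth sections. *Polyhomogeneous conormal functions.* A smooth function $g:X^\circ\to\mathbb R$ is *polyhomogeneous conormal* if for every chart of $X$ and every point $u$ of it, with $Z$ the set of boundary coordinates that vanish at $u$, there is near $u$ an asymptotic expansion $$g\sim\sum_{(\alpha_i,b_i)\in E_i,\ i\in Z}G_{(\alpha_i,b_i)_{i\in Z}}\big((x_j)_{j\notin Z}\big)\prod_{i\in Z}x_i^{\alpha_i}\log^{b_i}x_i,$$ where each $E_i\subset\mathbb C\times\mathbb N$ has only finitely many elements with $\operatorname{Re}\alpha\le N$, for every $N$, and the coefficients are smooth and complex-valued. The expansion is understood face by face: near $u$ there are a fixed neighbourhood, a fixed $M\in\mathbb R$ and smooth functions $G_{I,\iota}$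 of the coordinates $x_j$, $j\notin I$, defined where all boundary coordinates are positive, for $I\subseteq Z$ and $\iota\in\prod_{i\in I}E_i$, with $G_\emptyset=g$ and $G_{Z,\iota}$ the coefficients above, such that for all $I$, $\iota$, all $i\in Z\setminus I$ and all $N\in\mathbb R$, $$G_{I,\iota}-\sum_{(\alpha,b)\in E_i,\ \operatorname{Re}\alpha\le N}G_{I\cup\{i\},(\iota,(\alpha,b))}\,x_i^\alpha\log^bx_i=O\Big(x_i^N\prod_{j\in Z\setminus(I\cup\{i\})}x_j^{-M}\Big)$$ on the neighbourhood, together with all iterated b-derivatives. For a component $\partial_iX$ of $\partial X$, the *index set* $S_i\subset\mathbb C\times\mathbb N$ of $g$ is the set of all $(\alpha,b)$ such that a nonzero term with factor $x_i^\alpha\log^bx_i$ occurs in the expansion of $g$ near some point of $\partial_iX$, where $\partial_iX$ is locally defined by $x_i=0$. **Lemma 5.2.** Let $X$ be a manifold with corners, $g:X^\circ\to\mathbb R$ a polyhomogeneous conormal function, $\tilde X$ the corresponding manifold with a-corners, and $\lambda\in W(\tilde X)$. Suppose that for every connected component $\partial_iX$ of $\partial X$, with $\lambda_i\in\mathbb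 R$ the value of $\lambda$ on $\partial_iX$ in charts of $X$, every $(\alpha,b)\in S_i$ satisfies either $\lambda_i=\alpha$ and $b=0$, or $\lambda_i<\operatorname{Re}\alpha$. Then there is a unique a-smooth section $\tilde g\in\Gamma^\infty(L_\lambda)$ with $\tilde g|_{\tilde X^\circ}=g$. -/

import Mathlib

open scoped ContDiff Topology

noncomputable section

namespace ACorners

/-! ### Local models, b-derivatives, smooth and a-smooth functions -/

/-- The local model `[0,∞)^k × ℝ^(m-k)`: the first `k` coordinates are nonnegative. -/
def corner (m k : ℕ) : Set (Fin m → ℝ) := {x | ∀ i : Fin m, (i : ℕ) < k → 0 ≤ x i}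

/-- The faces `{x_i = 0}`, `i < k`, of `[0,∞)^k × ℝ^(m-k)` that pass through `u`. -/
def zeroFaces {m : ℕ} (k : ℕ) (u : Fin m → ℝ) : Finset (Fin m) :=
  open Classical in Finset.univ.filter fun i => (i : ℕ) < k ∧ u i = 0

/-- The `i`-th b-derivative: `x_i ∂f/∂x_i` for `i < k` (this is `0` where `x_i = 0`), and
`∂f/∂x_i` for `i ≥ k`. -/
def bDeriv {m : ℕ} {E : Type*} [NormedAddCommGroup E] [NormedSpace ℝ E] (k : ℕ) (i : Fin m)
    (f : (Fin m → ℝ) → E) : (Fin m → ℝ) → E := fun x =>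
  (if (i : ℕ) < k then x i else 1) • deriv (fun t : ℝ => f (Function.update x i t)) (x i)

/-- Iterated b-derivatives; the entries of the list are the directions. -/
def bDerivs {m : ℕ} {E : Type*} [NormedAddCommGroup E] [NormedSpace ℝ E] (k : ℕ)
    (l : List (Fin m)) (f : (Fin m → ℝ) → E) : (Fin m → ℝ) → E :=
  l.foldr (fun i h => bDeriv k i h) f

/-- `f` is a-smooth on `U`, a relatively open subset of `corner m k`: all iterated b-derivatives
exist and are continuous on `U`, and a b-derivative `x_i ∂/∂x_i` (`i < k`) of any of them is
`O(x_i ^ α)` for some `α > 0` on each compact subset of `U`. -/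
structure ASmooth {m : ℕ} (k : ℕ) (U : Set (Fin m → ℝ)) (f : (Fin m → ℝ) → ℝ) : Prop where
  continuousOn : ∀ l : List (Fin m), ContinuousOn (bDerivs k l f) U
  differentiable : ∀ (l : List (Fin m)) (i : Fin m), ∀ x ∈ U, ((i : ℕ) < k → 0 < x i) →
    DifferentiableAt ℝ (fun t : ℝ => bDerivs k l f (Function.update x i t)) (x i)
  decay : ∀ (l : List (Fin m)) (i : Fin m), (i : ℕ) < k → ∀ S ⊆ U, IsCompact S →
    ∃ C > 0, ∃ α > 0, ∀ x ∈ S, |bDerivs k (i :: l) f x| ≤ C * x i ^ (α : ℝ)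

/-- On `W` (a neighbourhood of `u`), `f = F · ∏ x_i ^ (a_i)` with `F > 0` a-smooth and real
exponents `a_i ≥ 0`, which vanish unless `{x_i = 0}` is a face through `u`. -/
def AMonomial {m : ℕ} (k : ℕ) (W : Set (Fin m → ℝ)) (u : Fin m → ℝ) (f : (Fin m → ℝ) → ℝ)
    (a : Fin m → ℝ) : Prop :=
  (∀ i, 0 ≤ a i) ∧ (∀ i, i ∉ zeroFaces k u → a i = 0) ∧
    ∃ F : (Fin m → ℝ) → ℝ, ASmooth k W F ∧ (∀ x ∈ W, 0 < F x) ∧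
      ∀ x ∈ W, f x = F x * ∏ i, x i ^ a i

/-- A-smooth maps from `U ⊆ corner m k` to `corner n l`. -/
def ASmoothMap {m n : ℕ} (k l : ℕ) (U : Set (Fin m → ℝ)) (f : (Fin m → ℝ) → (Fin n → ℝ)) :
    Prop :=
  ContinuousOn f U ∧
  (∀ j : Fin n, l ≤ (j : ℕ) → ASmooth k U fun x => f x j) ∧
  ∀ u ∈ U, ∃ O : Set (Fin m → ℝ), IsOpen O ∧ u ∈ O ∧ ∀ j : Fin n, (j : ℕ) < l →
    (∃ a : Fin m → ℝ, AMonomial k (U ∩ O) u (fun x => f x j) a) ∨ ∀ x ∈ U ∩ O, f x j = 0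

/-- Smooth maps from `U ⊆ corner m k` to `corner n l` (Melrose's b-maps): all derivatives exist
and are continuous up to the boundary, and each `[0,∞)`-valued component is locally
zero, or a positive smooth function times a monomial with natural number exponents. -/
def SmoothMap {m n : ℕ} (k l : ℕ) (U : Set (Fin m → ℝ)) (f : (Fin m → ℝ) → (Fin n → ℝ)) :
    Prop :=
  ContDiffOn ℝ ∞ f U ∧
  ∀ u ∈ U, ∃ O : Set (Fin m → ℝ), IsOpen O ∧ u ∈ O ∧ ∀ j : Fin n, (j : ℕ) < l →
    (∃ a : Fin m → ℕ, (∀ i, i ∉ zeroFaces k u → a i = 0) ∧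
      ∃ F : (Fin m → ℝ) → ℝ, ContDiffOn ℝ ∞ F (U ∩ O) ∧ (∀ x ∈ U ∩ O, 0 < F x) ∧
        ∀ x ∈ U ∩ O, f x j = F x * ∏ i, x i ^ a i) ∨ ∀ x ∈ U ∩ O, f x j = 0

/-! ### Charts and manifolds with corners -/

/-- An `m`-dimensional chart on `X`: a homeomorphism from a relatively open subset `source` of
`[0,∞)^k × ℝ^(m-k)` onto an open subset `target` of `X`. The same notion serves for charts of
manifolds with corners and for a-charts; these differ only in their compatibility. -/
structure Chart (X : Type*) [TopologicalSpace X] (m : ℕ) extends PartialEquiv (Fin m → ℝ) X where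
  k : ℕ
  k_le : k ≤ m
  source_open : ∃ O : Set (Fin m → ℝ), IsOpen O ∧ source = O ∩ corner m k
  target_open : IsOpen target
  continuousOn_toFun : ContinuousOn toFun source
  continuousOn_invFun : ContinuousOn invFun target

section Charts

variable {X : Type*} [TopologicalSpace X] {m : ℕ}

/-- The part of the domain of `c` that lies over the image of `c'`. -/
def Chart.overlap (c c' : Chart X m) : Set (Fin m → ℝ) :=
  c.source ∩ c.toFun ⁻¹' c'.target

/-- The change of coordinates from `c` to `c'`. -/
def Chart.change (c c' : Chart X m) : (Fin m → ℝ) → (Fin m → ℝ) := fun x => c'.invFun (c.toFun x)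

/-- The change of coordinates is a diffeomorphism in the sense of manifolds with corners. -/
def Compatible (c c' : Chart X m) : Prop :=
  SmoothMap c.k c'.k (c.overlap c') (c.change c') ∧
  SmoothMap c'.k c.k (c'.overlap c) (c'.change c)

/-- The change of coordinates is an a-diffeomorphism. -/
def ACompatible (c c' : Chart X m) : Prop :=
  ASmoothMap c.k c'.k (c.overlap c') (c.change c') ∧
  ASmoothMap c'.k c.k (c'.overlap c) (c'.change c)

/-- The points that have depth `0` in some chart of `A`. -/
def interiorOf (A : Set (Chart X m)) : Set X :=
  {x | ∃ c ∈ A, x ∈ c.target ∧ zeroFaces c.k (c.invFun x) = ∅}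

/-- All faces `{x_i = 0}` of the chart are connected or empty. -/
def Chart.Good (c : Chart X m) : Prop :=
  ∀ i : Fin m, (i : ℕ) < c.k → IsPreconnected {u | u ∈ c.source ∧ u i = 0}

end Charts

/-- The structure of an `m`-dimensional manifold with corners on `X`: a maximal atlas. (That `X` is
Hausdorff and second countable is assumed separately.) -/
structure CornersStructure (X : Type*) [TopologicalSpace X] (m : ℕ) where
  atlas : Set (Chart X m)
  compatible : ∀ c ∈ atlas, ∀ c' ∈ atlas, Compatible c c'
  cover : ∀ x : X, ∃ c ∈ atlas, x ∈ c.target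
  maximal : ∀ c : Chart X m, (∀ c' ∈ atlas, Compatible c c') → c ∈ atlas

/-! ### Polyhomogeneous conormal functions -/

/-- An asymptotic expansion of `h` near the point `u` of the relatively open subset `U` of
`corner m k`, with respect to the coordinates `x_i`, `i ∈ Z = zeroFaces k u`, that vanish at `u`:
`h ∼ ∑_ι G_ι · ∏_{i ∈ Z} x_i ^ α_i * (log x_i) ^ b_i`, where `ι i = (α_i, b_i) ∈ E i` and
`G_ι = G Z ι` depends on the remaining coordinates only.

The symbol `∼` is meant in the usual sense for manifolds with corners: `h` has an expansion at each
single face `x_i = 0`, its coefficients (functions on that face) have expansions at the other faces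
in turn, and so on. Thus `G I ι`, for `I ⊆ Z`, is the coefficient of
`∏_{i ∈ I} x_i ^ α_i * (log x_i) ^ b_i`, a function of the coordinates `x_j`, `j ∉ I`. In each of
these one-face expansions the remainder after the terms with `Re α ≤ N` is `O(x_i ^ N)` together
with all its b-derivatives, with at most polynomial growth of a fixed order `M` at the other
faces. -/
structure PhgExpansion {m : ℕ} (k : ℕ) (U : Set (Fin m → ℝ)) (h : (Fin m → ℝ) → ℝ)
    (u : Fin m → ℝ) where
  ε : ℝ
  ε_pos : 0 < ε
  ball_subset : Metric.ball u ε ∩ corner m k ⊆ U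
  /-- the exponents `(α, b)` that are allowed at the face `x_i = 0` -/
  E : Fin m → Set (ℂ × ℕ)
  E_finite : ∀ (i : Fin m) (N : ℝ), {p : ℂ × ℕ | p ∈ E i ∧ p.1.re ≤ N}.Finite
  G : Finset (Fin m) → (Fin m → ℂ × ℕ) → (Fin m → ℝ) → ℂ
  G_empty : ∀ ι, ∀ x ∈ Metric.ball u ε, (∀ i : Fin m, (i : ℕ) < k → 0 < x i) →
    G ∅ ι x = (h x : ℂ)
  G_index : ∀ I ι ι', (∀ i ∈ I, ι i = ι' i) → G I ι = G I ι'
  G_const : ∀ I ι x y, (∀ j, j ∉ I → x j = y j) → G I ι x = G I ι y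
  G_smooth : ∀ I ⊆ zeroFaces k u, ∀ ι, (∀ i ∈ I, ι i ∈ E i) →
    ContDiffOn ℝ ∞ (G I ι) {x | x ∈ Metric.ball u ε ∧ ∀ i : Fin m, (i : ℕ) < k → 0 < x i}
  M : ℝ
  remainder : ∀ I ⊆ zeroFaces k u, ∀ i ∈ zeroFaces k u, i ∉ I → ∀ ι, (∀ j ∈ I, ι j ∈ E j) →
    ∀ (N : ℝ) (l : List (Fin m)), ∃ C : ℝ,
      ∀ x ∈ Metric.ball u ε, (∀ j : Fin m, (j : ℕ) < k → 0 < x j) →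
        ‖bDerivs k l (fun y => G I ι y - ∑ p ∈ (E_finite i N).toFinset,
            G (insert i I) (Function.update ι i p) y *
              ((y i : ℂ) ^ p.1 * (Real.log (y i) : ℂ) ^ p.2)) x‖
          ≤ C * x i ^ N * ∏ j ∈ zeroFaces k u \ insert i I, x j ^ (-M)

/-- Some nonzero term of the expansion contains the factor `x_i ^ α * (log x_i) ^ b`,
`p = (α, b)`. -/
def PhgExpansion.Occurs {m k : ℕ} {U : Set (Fin m → ℝ)} {h : (Fin m → ℝ) → ℝ} {u : Fin m → ℝ}
    (P : PhgExpansion k U h u) (i : Fin m) (p : ℂ × ℕ) : Prop :=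
  ∃ ι : Fin m → ℂ × ℕ, (∀ j ∈ zeroFaces k u, ι j ∈ P.E j) ∧ ι i = p ∧
    ∃ x ∈ Metric.ball u P.ε, (∀ j : Fin m, (j : ℕ) < k → 0 < x j) ∧ P.G (zeroFaces k u) ι x ≠ 0

namespace CornersStructure

variable {X : Type*} [TopologicalSpace X] {m : ℕ} (M : CornersStructure X m)

/-- The interior `X°`. -/
def interior : Set X := interiorOf M.atlas

/-- `g`, of which only the values on `X°` matter, is smooth on `X°` and has an asymptotic expansion
near each point in all local coordinates. (At points of `X°` the second part says nothing.) -/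
def IsPolyhomogeneous (g : X → ℝ) : Prop :=
  (∀ c ∈ M.atlas, ContDiffOn ℝ ∞ (g ∘ c.toFun)
    {u | u ∈ c.source ∧ ∀ i : Fin m, (i : ℕ) < c.k → 0 < u i}) ∧
  ∀ c ∈ M.atlas, ∀ u ∈ c.source, Nonempty (PhgExpansion c.k c.source (g ∘ c.toFun) u)

/-- A point of `∂X`, presented by a chart, a point of its domain, and a face of the domain through
this point. -/
structure BoundaryPoint where
  chart : Chart X m
  mem_atlas : chart ∈ M.atlas
  pt : Fin m → ℝ
  mem_source : pt ∈ chart.source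
  face : Fin m
  mem_face : face ∈ zeroFaces chart.k pt

/-- Two presentations give the same point of `∂X` (the same point of `X` and the same local
boundary component), or they are joined by a connected set within a face of one chart. -/
inductive BoundaryStep : M.BoundaryPoint → M.BoundaryPoint → Prop
  | same_point (p q : M.BoundaryPoint) (hpq : p.chart.toFun p.pt = q.chart.toFun q.pt)
      (hface : ∀ᶠ y in 𝓝 (p.chart.toFun p.pt),
        p.chart.invFun y p.face = 0 ↔ q.chart.invFun y q.face = 0) : BoundaryStep p q
  | same_face (p q : M.BoundaryPoint) (hchart : p.chart = q.chart) (hface : p.face = q.face)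
      (T : Set (Fin m → ℝ)) (hT : IsPreconnected T)
      (hsub : ∀ u ∈ T, u ∈ p.chart.source ∧ u p.face = 0) (hp : p.pt ∈ T) (hq : q.pt ∈ T) :
      BoundaryStep p q

/-- The two boundary points lie in the same connected component of `∂X`. -/
def SameComponent : M.BoundaryPoint → M.BoundaryPoint → Prop :=
  Relation.EqvGen M.BoundaryStep

/-- The index set of `g` at the component of `∂X` that contains `p`: all `(α, b)` such that a nonzero
term with factor `x_i ^ α * (log x_i) ^ b` occurs in the expansion of `g` at some point of this
component, defined locally by `x_i = 0`. -/
def indexSet (g : X → ℝ) (p : M.BoundaryPoint) : Set (ℂ × ℕ) :=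
  {r | ∃ q : M.BoundaryPoint, M.SameComponent p q ∧
    ∃ P : PhgExpansion q.chart.k q.chart.source (g ∘ q.chart.toFun) q.pt, P.Occurs q.face r}

/-- The maximal a-atlas generated by the charts of `X`: all a-charts that are a-compatible with
every chart of `X`. It is the a-atlas of the manifold with a-corners corresponding to `X`. -/
def aAtlas : Set (Chart X m) := {c | ∀ c' ∈ M.atlas, ACompatible c c'}

end CornersStructure

/-! ### Weights and the line bundles `L_λ` over a manifold with a-corners -/

section Weights

variable {X : Type*} [TopologicalSpace X] {m : ℕ}

/-- A weight on the manifold with a-corners with a-atlas `A`, given by its coefficients in a-charts: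
a constant `val c i = λ_i` on each face `x_i = 0` of each a-chart `c` whose faces are connected,
with `λ_i = 0` for an empty face. If `x̃_j = F_j · ∏ x_i ^ (a_ij)` is the change of coordinates near a
point with `x_i = 0`, then `λ_i = ∑_j a_ij λ̃_j`. -/
structure Weight (A : Set (Chart X m)) where
  val : Chart X m → Fin m → ℝ
  val_empty : ∀ c ∈ A, c.Good → ∀ i : Fin m, (i : ℕ) < c.k →
    (∀ u ∈ c.source, u i ≠ 0) → val c i = 0
  val_change : ∀ c ∈ A, c.Good → ∀ c' ∈ A, c'.Good → ∀ u ∈ c.overlap c',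
    ∀ O : Set (Fin m → ℝ), IsOpen O → u ∈ O → ∀ a : Fin m → Fin m → ℝ,
    (∀ j : Fin m, (j : ℕ) < c'.k →
      AMonomial c.k (c.overlap c' ∩ O) u (fun x => c.change c' x j) fun i => a i j) →
    ∀ i ∈ zeroFaces c.k u,
      val c i = ∑ j : Fin m, if (j : ℕ) < c'.k then a i j * val c' j else 0

namespace Weight

variable {A : Set (Chart X m)} (w : Weight A)

/-- The function `x_1 ^ λ_1 ⋯ x_k ^ λ_k` of a chart. Over the interior, the basis section `e_c` of
`L_λ` over the image of `c` is identified with it. -/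
def mono (c : Chart X m) (x : X) : ℝ :=
  ∏ i : Fin m, if (i : ℕ) < c.k then c.invFun x i ^ w.val c i else 1

/-- The transition function of `L_λ`, `e_{c'} = trans c c' · e_c`: the continuous extension of
`x̃_1 ^ λ̃_1 ⋯ x̃_l ^ λ̃_l * x_1 ^ (-λ_1) ⋯ x_k ^ (-λ_k)` from the interior. -/
def trans (c c' : Chart X m) (x : X) : ℝ :=
  Filter.limUnder (𝓝[interiorOf A] x) fun y => w.mono c' y / w.mono c y

/-- The a-charts that give a basis section `e_c` of `L_λ` near `x`. -/
def Frame (_w : Weight A) (x : X) : Type _ := {c : Chart X m // c ∈ A ∧ c.Good ∧ x ∈ c.target}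

/-- The fibre of `L_λ` at `x`: a vector is the compatible family of its coefficients with respect to
all the basis sections `e_c`. -/
def fibre (x : X) : Submodule ℝ (w.Frame x → ℝ) where
  carrier := {v | ∀ c c' : w.Frame x, v c = w.trans c.1 c'.1 x * v c'}
  add_mem' := by
    intro v v' hv hv' c c'
    simp only [Pi.add_apply, mul_add]
    rw [← hv c c', ← hv' c c']
  zero_mem' := by
    intro c c'
    simp
  smul_mem' := by
    intro t v hv c c'
    simp only [Pi.smul_apply, smul_eq_mul]
    rw [hv c c']
    ring

/-- `s` is an a-smooth section of `L_λ`: every point has an a-chart `c` around it such that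
`s = f · e_c` with `f` a-smooth. (Changes of a-charts and of basis sections are a-smooth, so it does
not matter which a-charts are used.) -/
def IsASmoothSection (s : ∀ x, w.fibre x) : Prop :=
  ∀ x : X, ∃ c : w.Frame x, ∃ f : (Fin m → ℝ) → ℝ, ASmooth c.1.k c.1.source f ∧
    ∀ u (hu : u ∈ c.1.source),
      f u = (s (c.1.toFun u)).1 ⟨c.1, c.2.1, c.2.2.1, c.1.map_source hu⟩

/-- On the subset `Y` of the interior, `s` is the function `g` under the canonical isomorphism of
`L_λ` with the trivial line bundle, which identifies `e_c` with `x_1 ^ λ_1 ⋯ x_k ^ λ_k`. -/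
def RestrictsTo (s : ∀ x, w.fibre x) (g : X → ℝ) (Y : Set X) : Prop :=
  ∀ x ∈ Y, ∀ c : w.Frame x, (s x).1 c * w.mono c.1 x = g x

end Weight

end Weights

end ACorners

end

noncomputable section

namespace ACorners

/-! ### Calculus of b-derivatives on open sets -/

section Calculus

variable {m k : ℕ} {E : Type*} [NormedAddCommGroup E] [NormedSpace ℝ E]
  {Ω : Set (Fin m → ℝ)} {f h : (Fin m → ℝ) → E} {x : Fin m → ℝ}

/-! Near a point `u` let `Z` be the set of faces through `u`, and put `f = g · ∏_{i ∈ Z} x_i ^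
(-λ_i)`. The coefficient of the required section is the extension of `f` to the boundary. Thus `f`
and its iterated b-derivatives must extend continuously, and `x_i ∂/∂x_i` of them must be `O(x_i ^
δ)` for some `δ > 0`.

Bounds. With all b-derivatives, each coefficient `G I ι` is `O(∏_{j ∈ Z \ I} x_j ^ λ_j)`
(`conormalOn_coeff`), by downward induction on `I`. The expansions are given at one face at a time,
and their remainders may blow up at the other faces. But where `x_i` is the smallest of the
coordinates, a high power of `x_i` outweighs fixed negative powers of the others. So at each point
the expansion at the nearest face is used, to a high enough order (`ConormalOn.of_faces`).

Decay. The operator `x_i ∂/∂x_i - λ_i` kills `x_i ^ λ_i`, and all other exponents exceed `λ_i` by a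
definite gap, because exponent sets are finite below any bound. The same induction therefore gains a
factor `x_i ^ δ` (`conormalOn_bDeriv_coeff_sub`). Division by the leading monomial turns this
operator into `x_i ∂/∂x_i` acting on `f`.

The index sets see only full coefficients `G Z ι`. A partial coefficient `G I ι` is a full one at
the nearby points where exactly the coordinates in `I` vanish, so the hypothesis controls it too
(`dominates_of_occurs`).

Extension. Decay gives `∂f/∂x_i = O(x_i ^ (δ - 1))`, which is integrable up to the face. Hence `f`
and its b-derivatives are Cauchy at boundary points, and differentiation commutes with the extension
(`BBounds.aSmooth_extend`).

Globally, the rule for weights makes quotients of the monomials of two charts converge to positive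
limits (`exists_tendsto_mono_div`). So the limits of `g` divided by these monomials form a
compatible family, that is, a section. It is unique because the interior is dense. -/

theorem hasDerivAt_line (hf : DifferentiableAt ℝ f x) (i : Fin m) :
    HasDerivAt (fun t : ℝ => f (Function.update x i t)) (fderiv ℝ f x (Pi.single i 1)) (x i) := by
  have h1 : HasFDerivAt f (fderiv ℝ f x) (Function.update x i (x i)) := by
    simpa using hf.hasFDerivAt
  exact h1.comp_hasDerivAt (x i) (hasDerivAt_update x i (x i))

theorem continuous_update_right (x : Fin m → ℝ) (i : Fin m) :
    Continuous fun t : ℝ => Function.update x i t :=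
  continuous_const.update i continuous_id

theorem eventually_update_mem (hΩ : IsOpen Ω) (hx : x ∈ Ω) (i : Fin m) :
    ∀ᶠ t in 𝓝 (x i), Function.update x i t ∈ Ω := by
  apply (continuous_update_right x i).continuousAt.eventually_mem
  rw [Function.update_eq_self]
  exact hΩ.mem_nhds hx

theorem bDeriv_congr (hΩ : IsOpen Ω) (hfh : Set.EqOn f h Ω) (i : Fin m) :
    Set.EqOn (bDeriv k i f) (bDeriv k i h) Ω := by
  intro x hx
  have : (fun t : ℝ => f (Function.update x i t)) =ᶠ[𝓝 (x i)]
      fun t : ℝ => h (Function.update x i t) :=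
    (eventually_update_mem hΩ hx i).mono fun t ht => hfh ht
  simp only [bDeriv, this.deriv_eq]

theorem bDerivs_cons (i : Fin m) (l : List (Fin m)) (f : (Fin m → ℝ) → E) :
    bDerivs k (i :: l) f = bDeriv k i (bDerivs k l f) := rfl

theorem bDerivs_append (l l' : List (Fin m)) (f : (Fin m → ℝ) → E) :
    bDerivs k (l ++ l') f = bDerivs k l (bDerivs k l' f) := by
  simp [bDerivs, List.foldr_append]

theorem bDerivs_concat (l : List (Fin m)) (i : Fin m) (f : (Fin m → ℝ) → E) :
    bDerivs k (l ++ [i]) f = bDerivs k l (bDeriv k i f) :=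
  bDerivs_append l [i] f

theorem bDerivs_congr (hΩ : IsOpen Ω) (hfh : Set.EqOn f h Ω) (l : List (Fin m)) :
    Set.EqOn (bDerivs k l f) (bDerivs k l h) Ω := by
  induction l with
  | nil => exact hfh
  | cons i l ih => exact bDeriv_congr hΩ ih i

theorem bDeriv_of_hasDerivAt {i : Fin m} {f' : E}
    (hf : HasDerivAt (fun t : ℝ => f (Function.update x i t)) f' (x i)) :
    bDeriv k i f x = (if (i : ℕ) < k then x i else 1) • f' := by
  simp only [bDeriv, hf.deriv]

theorem bDeriv_eq_fderiv (hf : DifferentiableAt ℝ f x) (i : Fin m) :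
    bDeriv k i f x = (if (i : ℕ) < k then x i else 1) • fderiv ℝ f x (Pi.single i 1) :=
  bDeriv_of_hasDerivAt (hasDerivAt_line hf i)

theorem contDiff_bCoeff (i : Fin m) :
    ContDiff ℝ ∞ fun x : Fin m → ℝ => if (i : ℕ) < k then x i else 1 := by
  split_ifs
  · exact contDiff_apply ℝ ℝ i
  · exact contDiff_const

theorem _root_.ContDiffOn.differentiableAt_of_isOpen (hf : ContDiffOn ℝ ∞ f Ω) (hΩ : IsOpen Ω)
    (hx : x ∈ Ω) : DifferentiableAt ℝ f x :=
  (hf.differentiableOn (by simp)).differentiableAt (hΩ.mem_nhds hx)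

theorem contDiffOn_bDeriv (hΩ : IsOpen Ω) (hf : ContDiffOn ℝ ∞ f Ω) (i : Fin m) :
    ContDiffOn ℝ ∞ (bDeriv k i f) Ω := by
  have h1 : ContDiffOn ℝ ∞ (fun x => (if (i : ℕ) < k then x i else 1) •
      fderiv ℝ f x (Pi.single i 1)) Ω :=
    (contDiff_bCoeff i).contDiffOn.smul
      ((hf.fderiv_of_isOpen hΩ (m := ∞) (by simp)).clm_apply contDiffOn_const)
  exact h1.congr fun x hx => bDeriv_eq_fderiv (hf.differentiableAt_of_isOpen hΩ hx) i

theorem contDiffOn_bDerivs (hΩ : IsOpen Ω) (hf : ContDiffOn ℝ ∞ f Ω) (l : List (Fin m)) :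
    ContDiffOn ℝ ∞ (bDerivs k l f) Ω := by
  induction l with
  | nil => exact hf
  | cons i l ih => exact contDiffOn_bDeriv hΩ ih i

theorem bDeriv_add (hf : DifferentiableAt ℝ f x) (hh : DifferentiableAt ℝ h x) (i : Fin m) :
    bDeriv k i (fun y => f y + h y) x = bDeriv k i f x + bDeriv k i h x := by
  rw [bDeriv_of_hasDerivAt ((hasDerivAt_line hf i).fun_add (hasDerivAt_line hh i)),
    bDeriv_eq_fderiv hf, bDeriv_eq_fderiv hh, smul_add]

theorem bDerivs_add (hΩ : IsOpen Ω) (hf : ContDiffOn ℝ ∞ f Ω) (hh : ContDiffOn ℝ ∞ h Ω)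
    (l : List (Fin m)) :
    Set.EqOn (bDerivs k l fun y => f y + h y) (fun y => bDerivs k l f y + bDerivs k l h y) Ω := by
  induction l with
  | nil => exact fun x _ => rfl
  | cons i l ih =>
    intro x hx
    rw [bDerivs_cons, bDeriv_congr hΩ ih i hx]
    exact bDeriv_add ((contDiffOn_bDerivs hΩ hf l).differentiableAt_of_isOpen hΩ hx)
      ((contDiffOn_bDerivs hΩ hh l).differentiableAt_of_isOpen hΩ hx) i

theorem bDeriv_mul {f h : (Fin m → ℝ) → ℂ} (hf : DifferentiableAt ℝ f x)
    (hh : DifferentiableAt ℝ h x) (i : Fin m) :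
    bDeriv k i (fun y => f y * h y) x = bDeriv k i f x * h x + f x * bDeriv k i h x := by
  rw [bDeriv_of_hasDerivAt ((hasDerivAt_line hf i).fun_mul (hasDerivAt_line hh i)),
    bDeriv_eq_fderiv hf, bDeriv_eq_fderiv hh]
  simp only [Function.update_eq_self, smul_add, smul_mul_assoc, mul_smul_comm]

/-- For distinct directions the factor `x_j` does not depend on `x_i`, so it passes through
`∂/∂x_i`, and the symmetry of the second derivative remains. -/
theorem bDeriv_comm (hΩ : IsOpen Ω) (hf : ContDiffOn ℝ ∞ f Ω) (i j : Fin m) :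
    Set.EqOn (bDeriv k i (bDeriv k j f)) (bDeriv k j (bDeriv k i f)) Ω := by
  rcases eq_or_ne i j with rfl | hij
  · exact fun x _ => rfl
  have key : ∀ i j : Fin m, i ≠ j → ∀ x ∈ Ω, bDeriv k i (bDeriv k j f) x =
      (if (i : ℕ) < k then x i else 1) • (if (j : ℕ) < k then x j else 1) •
        fderiv ℝ (fderiv ℝ f) x (Pi.single i 1) (Pi.single j 1) := by
    intro i j hij x hx
    have hd : DifferentiableAt ℝ (fderiv ℝ f) x :=
      (hf.fderiv_of_isOpen hΩ (m := ∞) (by simp)).differentiableAt_of_isOpen hΩ hx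
    have h1 := ((hasDerivAt_line hd i).clm_apply
      (hasDerivAt_const (x i) (Pi.single j (1 : ℝ)))).fun_const_smul
        (if (j : ℕ) < k then x j else 1)
    refine (bDeriv_of_hasDerivAt (f' := (if (j : ℕ) < k then x j else 1) •
      fderiv ℝ (fderiv ℝ f) x (Pi.single i 1) (Pi.single j 1)) ?_)
    refine HasDerivAt.congr_of_eventuallyEq (by simpa using h1) ?_
    filter_upwards [eventually_update_mem hΩ hx i] with t ht
    rw [bDeriv_eq_fderiv (hf.differentiableAt_of_isOpen hΩ ht)]
    simp [Function.update_of_ne hij.symm]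
  intro x hx
  rw [key i j hij x hx, key j i hij.symm x hx, smul_comm]
  congr 2
  have hc : ContDiffAt ℝ ∞ f x := hf.contDiffAt (hΩ.mem_nhds hx)
  exact (hc.isSymmSndFDerivAt (by
    rw [minSmoothness_of_isRCLikeNormedField]; exact WithTop.coe_le_coe.2 le_top)) _ _

/-- Estimates are obtained for `x_i ∂/∂x_i` applied first, whereas the decay condition has it
applied last. -/
theorem bDerivs_bDeriv_comm (hΩ : IsOpen Ω) (hf : ContDiffOn ℝ ∞ f Ω) (i : Fin m)
    (l : List (Fin m)) :
    Set.EqOn (bDerivs k l (bDeriv k i f)) (bDeriv k i (bDerivs k l f)) Ω := by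
  induction l with
  | nil => exact fun x _ => rfl
  | cons j l ih =>
    intro x hx
    rw [bDerivs_cons, bDeriv_congr hΩ ih j hx]
    exact bDeriv_comm hΩ (contDiffOn_bDerivs hΩ hf l) j i hx

theorem bDerivs_ofReal (hΩ : IsOpen Ω) {f : (Fin m → ℝ) → ℝ} (hf : ContDiffOn ℝ ∞ f Ω)
    (l : List (Fin m)) :
    Set.EqOn (bDerivs k l fun y => (f y : ℂ)) (fun y => ((bDerivs k l f y : ℝ) : ℂ)) Ω := by
  induction l with
  | nil => exact fun x _ => rfl
  | cons i l ih =>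
    intro x hx
    have hd := (contDiffOn_bDerivs (k := k) hΩ hf l).differentiableAt_of_isOpen hΩ hx
    rw [bDerivs_cons, bDeriv_congr hΩ ih i hx,
      bDeriv_of_hasDerivAt (hasDerivAt_line hd i).ofReal_comp, bDerivs_cons]
    beta_reduce
    rw [bDeriv_eq_fderiv hd]
    split_ifs <;> simp

/-- Functions that do not depend on the coordinates in `I`. -/
def IndepOf (I : Finset (Fin m)) (f : (Fin m → ℝ) → E) : Prop :=
  ∀ x y, (∀ j, j ∉ I → x j = y j) → f x = f y

theorem IndepOf.bDeriv_eq_zero {I : Finset (Fin m)} (hf : IndepOf I f) {i : Fin m} (hi : i ∈ I) :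
    bDeriv k i f x = 0 := by
  have : (fun t : ℝ => f (Function.update x i t)) = fun _ => f x := by
    funext t
    exact hf _ _ fun j hj => Function.update_of_ne (by rintro rfl; exact hj hi) _ _
  simp [bDeriv, this]

theorem IndepOf.bDeriv {I : Finset (Fin m)} (hf : IndepOf I f) (i : Fin m) :
    IndepOf I (bDeriv k i f) := by
  intro x y hxy
  by_cases hi : i ∈ I
  · rw [hf.bDeriv_eq_zero hi, hf.bDeriv_eq_zero hi]
  · have : (fun t : ℝ => f (Function.update x i t)) = fun t : ℝ => f (Function.update y i t) := by
      funext t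
      apply hf
      intro j hj
      by_cases hji : j = i
      · subst hji; simp
      · simp [Function.update_of_ne hji, hxy j hj]
    simp [ACorners.bDeriv, this, hxy i hi]

theorem IndepOf.bDerivs {I : Finset (Fin m)} (hf : IndepOf I f) (l : List (Fin m)) :
    IndepOf I (bDerivs k l f) := by
  induction l with
  | nil => exact hf
  | cons i l ih => exact ih.bDeriv i

end Calculus

/-! ### Functions with all b-derivatives bounded by a weight -/

/-- `h` is smooth on `Ω` and all its iterated b-derivatives are `O(w)` there. -/
structure ConormalOn {m : ℕ} (k : ℕ) (Ω : Set (Fin m → ℝ)) (w : (Fin m → ℝ) → ℝ)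
    (h : (Fin m → ℝ) → ℂ) : Prop where
  smooth : ContDiffOn ℝ ∞ h Ω
  bound : ∀ l : List (Fin m), ∃ C : ℝ, ∀ x ∈ Ω, ‖bDerivs k l h x‖ ≤ C * w x

namespace ConormalOn

variable {m k : ℕ} {Ω : Set (Fin m → ℝ)} {w w' : (Fin m → ℝ) → ℝ} {f h : (Fin m → ℝ) → ℂ}

theorem congr (hΩ : IsOpen Ω) (hf : ConormalOn k Ω w f) (hfh : Set.EqOn h f Ω) :
    ConormalOn k Ω w h where
  smooth := hf.smooth.congr hfh
  bound l := by
    obtain ⟨C, hC⟩ := hf.bound l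
    exact ⟨C, fun x hx => by rw [bDerivs_congr hΩ hfh l hx]; exact hC x hx⟩

theorem weight_congr (hf : ConormalOn k Ω w f) (hw : ∀ x ∈ Ω, w x = w' x) :
    ConormalOn k Ω w' f where
  smooth := hf.smooth
  bound l := by
    obtain ⟨C, hC⟩ := hf.bound l
    exact ⟨C, fun x hx => hw x hx ▸ hC x hx⟩

theorem bDeriv (hΩ : IsOpen Ω) (hf : ConormalOn k Ω w f) (i : Fin m) :
    ConormalOn k Ω w (bDeriv k i f) where
  smooth := contDiffOn_bDeriv hΩ hf.smooth i
  bound l := by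
    obtain ⟨C, hC⟩ := hf.bound (l ++ [i])
    exact ⟨C, fun x hx => by rw [← bDerivs_concat]; exact hC x hx⟩

theorem add (hΩ : IsOpen Ω) (hf : ConormalOn k Ω w f) (hh : ConormalOn k Ω w h) :
    ConormalOn k Ω w fun y => f y + h y where
  smooth := hf.smooth.add hh.smooth
  bound l := by
    obtain ⟨C, hC⟩ := hf.bound l
    obtain ⟨C', hC'⟩ := hh.bound l
    refine ⟨C + C', fun x hx => ?_⟩
    rw [bDerivs_add hΩ hf.smooth hh.smooth l hx, add_mul]
    exact (norm_add_le _ _).trans (add_le_add (hC x hx) (hC' x hx))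

theorem zero : ConormalOn k Ω w fun _ => 0 where
  smooth := contDiffOn_const
  bound l := by
    have : bDerivs k l (fun _ : Fin m → ℝ => (0 : ℂ)) = fun _ => 0 := by
      induction l with
      | nil => rfl
      | cons i l ih => rw [bDerivs_cons, ih]; funext x; simp [ACorners.bDeriv]
    exact ⟨0, fun x hx => by simp [this]⟩

theorem sum (hΩ : IsOpen Ω) {ι : Type*} (s : Finset ι)
    {F : ι → (Fin m → ℝ) → ℂ} (hF : ∀ p ∈ s, ConormalOn k Ω w (F p)) :
    ConormalOn k Ω w fun y => ∑ p ∈ s, F p y := by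
  classical
  induction s using Finset.induction_on with
  | empty => simpa using zero
  | insert a s ha ih =>
    simp only [Finset.sum_insert ha]
    exact (hF a (Finset.mem_insert_self _ _)).add hΩ
      (ih fun p hp => hF p (Finset.mem_insert_of_mem hp))

theorem mul (hΩ : IsOpen Ω) (hw : ∀ x ∈ Ω, 0 ≤ w x) (hf : ConormalOn k Ω w f)
    (hh : ConormalOn k Ω w' h) : ConormalOn k Ω (fun x => w x * w' x) fun y => f y * h y where
  smooth := hf.smooth.mul hh.smooth
  bound l := by
    -- Splitting off the innermost derivative lets the induction hypothesis apply to the pairs `(∂f,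
    -- h)` and `(f, ∂h)`, which satisfy the same bounds as `(f, h)`.
    induction l using List.reverseRecOn generalizing f h with
    | nil =>
      obtain ⟨C, hC⟩ := hf.bound []
      obtain ⟨C', hC'⟩ := hh.bound []
      refine ⟨|C| * C', fun x hx => ?_⟩
      have h1 : ‖f x‖ ≤ |C| * w x :=
        (hC x hx).trans (mul_le_mul_of_nonneg_right (le_abs_self _) (hw x hx))
      calc ‖f x * h x‖ = ‖f x‖ * ‖h x‖ := norm_mul _ _
        _ ≤ (|C| * w x) * (C' * w' x) := mul_le_mul h1 (hC' x hx) (norm_nonneg _)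
            (mul_nonneg (abs_nonneg _) (hw x hx))
        _ = _ := by ring
    | append_singleton l i ih =>
      obtain ⟨C, hC⟩ := ih (hf.bDeriv hΩ i) hh
      obtain ⟨C', hC'⟩ := ih hf (hh.bDeriv hΩ i)
      refine ⟨C + C', fun x hx => ?_⟩
      have h1 : Set.EqOn (ACorners.bDeriv k i fun y => f y * h y)
          (fun y => ACorners.bDeriv k i f y * h y + f y * ACorners.bDeriv k i h y) Ω :=
        fun y hy => bDeriv_mul (hf.smooth.differentiableAt_of_isOpen hΩ hy)
          (hh.smooth.differentiableAt_of_isOpen hΩ hy) i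
      rw [bDerivs_concat, bDerivs_congr hΩ h1 l hx, bDerivs_add hΩ
        ((contDiffOn_bDeriv hΩ hf.smooth i).mul hh.smooth)
        (hf.smooth.mul (contDiffOn_bDeriv hΩ hh.smooth i)) l hx, add_mul]
      exact (norm_add_le _ _).trans (add_le_add (hC x hx) (hC' x hx))

theorem const (c : ℂ) : ConormalOn k Ω (fun _ => 1) fun _ => c where
  smooth := contDiffOn_const
  bound l := by
    have : ∀ c : ℂ, ∃ c' : ℂ, bDerivs k l (fun _ : Fin m → ℝ => c) = fun _ => c' := by
      intro c
      induction l with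
      | nil => exact ⟨c, rfl⟩
      | cons i l ih =>
        obtain ⟨c', hc'⟩ := ih
        refine ⟨0, ?_⟩
        rw [bDerivs_cons, hc']
        funext x
        simp [ACorners.bDeriv]
    obtain ⟨c', hc'⟩ := this c
    exact ⟨‖c'‖, fun x _ => by simp [hc']⟩

theorem const_mul (hΩ : IsOpen Ω) (hf : ConormalOn k Ω w f) (c : ℂ) :
    ConormalOn k Ω w fun y => c * f y :=
  ((const c).mul hΩ (fun _ _ => zero_le_one) hf).weight_congr fun _ _ => one_mul _

theorem sub (hΩ : IsOpen Ω) (hf : ConormalOn k Ω w f) (hh : ConormalOn k Ω w h) :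
    ConormalOn k Ω w fun y => f y - h y :=
  (hf.add hΩ (hh.const_mul hΩ (-1))).congr hΩ fun y _ => by ring

end ConormalOn

/-! ### The functions `x_i ^ α * Q (log x_i)` -/

section LogTerm

variable {m k : ℕ} {Ω : Set (Fin m → ℝ)}

/-- The function `x_i ^ α * Q (log x_i)`, for a polynomial `Q`. -/
def logTerm (i : Fin m) (α : ℂ) (Q : Polynomial ℂ) : (Fin m → ℝ) → ℂ :=
  fun y => (y i : ℂ) ^ α * Q.eval (Real.log (y i) : ℂ)

theorem hasDerivAt_logTerm (α : ℂ) (Q : Polynomial ℂ) {t : ℝ} (ht : 0 < t) :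
    HasDerivAt (fun t : ℝ => (t : ℂ) ^ α * Q.eval (Real.log t : ℂ))
      ((t : ℂ)⁻¹ * ((t : ℂ) ^ α * (Polynomial.C α * Q + Polynomial.derivative Q).eval
        (Real.log t : ℂ))) t := by
  have ht' : (t : ℂ) ≠ 0 := by exact_mod_cast ht.ne'
  have h1 : HasDerivAt (fun t : ℝ => (t : ℂ) ^ α) (α * (t : ℂ) ^ (α - 1)) t := by
    have := (hasDerivAt_id (t : ℂ)).cpow_const (c := α)
      (Complex.ofReal_mem_slitPlane.2 ht)
    simpa using this.comp_ofReal
  have h2 : HasDerivAt (fun t : ℝ => Q.eval (Real.log t : ℂ))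
      ((Polynomial.derivative Q).eval (Real.log t : ℂ) * ((t⁻¹ : ℝ) : ℂ)) t :=
    HasDerivAt.comp (h₂ := fun z => Q.eval z) (h := fun t : ℝ => (Real.log t : ℂ)) t
      (Q.hasDerivAt (Real.log t : ℂ)) (Real.hasDerivAt_log ht.ne').ofReal_comp
  refine (h1.fun_mul h2).congr_deriv ?_
  rw [Complex.cpow_sub _ _ ht', Complex.cpow_one]
  simp only [Polynomial.eval_add, Polynomial.eval_mul, Polynomial.eval_C, Complex.ofReal_inv]
  field_simp

/-- Polynomials in `log x_i`, rather than single powers, are admitted because this makes the class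
closed under `x_i ∂/∂x_i` with `α` fixed. -/
theorem bDeriv_logTerm {i : Fin m} (hi : (i : ℕ) < k) (α : ℂ) (Q : Polynomial ℂ)
    {x : Fin m → ℝ} (hx : 0 < x i) :
    bDeriv k i (logTerm i α Q) x =
      logTerm i α (Polynomial.C α * Q + Polynomial.derivative Q) x := by
  have h : HasDerivAt (fun t : ℝ => logTerm i α Q (Function.update x i t))
      ((x i : ℂ)⁻¹ * logTerm i α (Polynomial.C α * Q + Polynomial.derivative Q) x) (x i) := by
    simpa [logTerm] using hasDerivAt_logTerm α Q hx
  rw [bDeriv_of_hasDerivAt h, if_pos hi]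
  have hx' : (x i : ℂ) ≠ 0 := by exact_mod_cast hx.ne'
  rw [Complex.real_smul, mul_inv_cancel_left₀ hx']

theorem indepOf_logTerm {I : Finset (Fin m)} {i : Fin m} (hi : i ∉ I) (α : ℂ)
    (Q : Polynomial ℂ) : IndepOf I (logTerm i α Q) := by
  intro x y hxy
  simp [logTerm, hxy i hi]

theorem bDeriv_logTerm_of_ne {i j : Fin m} (hij : j ≠ i) (α : ℂ) (Q : Polynomial ℂ)
    (x : Fin m → ℝ) : bDeriv k j (logTerm i α Q) x = 0 :=
  (indepOf_logTerm (I := {j}) (by simpa using hij.symm) α Q).bDeriv_eq_zero (by simp)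

theorem contDiffOn_logTerm {i : Fin m} (hΩ : ∀ x ∈ Ω, 0 < x i) (α : ℂ) (Q : Polynomial ℂ) :
    ContDiffOn ℝ ∞ (logTerm i α Q) Ω := by
  have hlog : ContDiffOn ℝ ∞ (fun y : Fin m → ℝ => (Real.log (y i) : ℂ)) Ω :=
    Complex.ofRealCLM.contDiff.comp_contDiffOn
      ((contDiff_apply ℝ ℝ i).contDiffOn.log fun x hx => (hΩ x hx).ne')
  have hpow : ContDiffOn ℝ ∞ (fun y : Fin m → ℝ => (y i : ℂ) ^ α) Ω := by
    refine (hlog.mul (contDiffOn_const (c := α))).cexp.congr fun y hy => ?_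
    rw [Complex.cpow_def_of_ne_zero (by exact_mod_cast (hΩ y hy).ne'),
      Complex.ofReal_log (hΩ y hy).le]
  refine hpow.mul ?_
  simp only [Polynomial.eval_eq_sum_range]
  exact ContDiffOn.sum fun n _ => contDiffOn_const.mul (hlog.pow n)

theorem norm_cpow_mul_log_pow_le {s : ℝ} {α : ℂ} (hs : s < α.re) (n : ℕ) :
    ∃ C : ℝ, ∀ t : ℝ, 0 < t → t < 1 → ‖(t : ℂ) ^ α * (Real.log t : ℂ) ^ n‖ ≤ C * t ^ s := by
  -- The excess of `Re α` over `s` is cut into `n + 1` equal parts: `n` of them absorb one logarithm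
  -- each, and the last factor `t ^ η` is at most `1`.
  set η : ℝ := (α.re - s) / (n + 1) with hη
  have hη0 : 0 < η := div_pos (by linarith) (by positivity)
  refine ⟨(1 / η) ^ n, fun t ht ht1 => ?_⟩
  have h1 := (Real.abs_log_mul_self_rpow_lt t η ht ht1.le hη0).le
  have h2 : α.re = s + η * n + η := by rw [hη]; field_simp; ring
  have hle : t ^ η ≤ 1 := Real.rpow_le_one ht.le ht1.le hη0.le
  rw [norm_mul, norm_pow, Complex.norm_cpow_eq_rpow_re_of_pos ht, Complex.norm_real,
    Real.norm_eq_abs, h2, Real.rpow_add ht, Real.rpow_add ht, Real.rpow_mul ht.le,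
    Real.rpow_natCast]
  have h3 : (|Real.log t| * t ^ η) ^ n ≤ (1 / η) ^ n := by
    refine pow_le_pow_left₀ (by positivity) ?_ n
    rwa [abs_mul, abs_of_pos (Real.rpow_pos_of_pos ht η)] at h1
  calc t ^ s * (t ^ η) ^ n * t ^ η * |Real.log t| ^ n
      = (|Real.log t| * t ^ η) ^ n * t ^ s * t ^ η := by rw [mul_pow]; ring
    _ ≤ (1 / η) ^ n * t ^ s * 1 := by gcongr
    _ = _ := mul_one _

theorem norm_cpow_mul_eval_log_le {s : ℝ} {α : ℂ} {Q : Polynomial ℂ}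
    (hs : s < α.re ∨ s = α.re ∧ Q.natDegree = 0) :
    ∃ C : ℝ, ∀ t : ℝ, 0 < t → t < 1 → ‖(t : ℂ) ^ α * Q.eval (Real.log t : ℂ)‖ ≤ C * t ^ s := by
  rcases hs with hs | ⟨hs, hQ⟩
  · choose C hC using fun n => norm_cpow_mul_log_pow_le hs n
    refine ⟨∑ n ∈ Finset.range (Q.natDegree + 1), ‖Q.coeff n‖ * C n, fun t ht ht1 => ?_⟩
    rw [Polynomial.eval_eq_sum_range, Finset.mul_sum, Finset.sum_mul]
    refine (norm_sum_le _ _).trans (Finset.sum_le_sum fun n _ => ?_)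
    rw [mul_left_comm, norm_mul, mul_assoc]
    exact mul_le_mul_of_nonneg_left (hC n t ht ht1) (norm_nonneg _)
  · rw [Polynomial.eq_C_of_natDegree_eq_zero hQ]
    refine ⟨‖Q.coeff 0‖, fun t ht _ => ?_⟩
    rw [Polynomial.eval_C, norm_mul, Complex.norm_cpow_eq_rpow_re_of_pos ht, hs, mul_comm]

theorem conormalOn_logTerm (hΩ : IsOpen Ω) {i : Fin m} (hi : (i : ℕ) < k)
    (hpos : ∀ x ∈ Ω, 0 < x i ∧ x i < 1) {s : ℝ} {α : ℂ} {Q : Polynomial ℂ}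
    (hs : s < α.re ∨ s = α.re ∧ Q.natDegree = 0) :
    ConormalOn k Ω (fun x => x i ^ s) (logTerm i α Q) where
  smooth := contDiffOn_logTerm (fun x hx => (hpos x hx).1) α Q
  bound l := by
    -- The condition on `(α, Q)` survives differentiation: if `Q` is constant, so is `α Q + Q'`.
    -- This is why the borderline `s = Re α` is harmless without logarithms.
    have key : ∃ Q' : Polynomial ℂ, (s < α.re ∨ s = α.re ∧ Q'.natDegree = 0) ∧
        Set.EqOn (bDerivs k l (logTerm i α Q)) (logTerm i α Q') Ω := by
      induction l with
      | nil => exact ⟨Q, hs, fun x _ => rfl⟩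
      | cons j l ih =>
        obtain ⟨Q', hs', hQ'⟩ := ih
        by_cases hj : j = i
        · subst hj
          refine ⟨Polynomial.C α * Q' + Polynomial.derivative Q', hs'.imp_right ?_, fun x hx => ?_⟩
          · rintro ⟨h1, h2⟩
            refine ⟨h1, ?_⟩
            rw [Polynomial.eq_C_of_natDegree_eq_zero h2, Polynomial.derivative_C, add_zero,
              ← Polynomial.C_mul, Polynomial.natDegree_C]
          · rw [bDerivs_cons, bDeriv_congr hΩ hQ' j hx, bDeriv_logTerm hi α Q' (hpos x hx).1]
        · refine ⟨0, hs'.imp_right fun h => ⟨h.1, by simp⟩, fun x hx => ?_⟩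
          rw [bDerivs_cons, bDeriv_congr hΩ hQ' j hx, bDeriv_logTerm_of_ne hj]
          simp [logTerm]
    obtain ⟨Q', hs', hQ'⟩ := key
    obtain ⟨C, hC⟩ := norm_cpow_mul_eval_log_le hs'
    exact ⟨C, fun x hx => by
      rw [hQ' hx]; exact hC (x i) (hpos x hx).1 (hpos x hx).2⟩

theorem logTerm_X_pow (i : Fin m) (α : ℂ) (b : ℕ) (y : Fin m → ℝ) :
    logTerm i α (Polynomial.X ^ b) y = (y i : ℂ) ^ α * (Real.log (y i) : ℂ) ^ b := by
  simp [logTerm]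

end LogTerm

/-! ### Monomials in several coordinates -/

section Monomial

variable {m k : ℕ} {Ω : Set (Fin m → ℝ)}

theorem conormalOn_prod_cpow (hΩ : IsOpen Ω) {s : Finset (Fin m)} (hs : ∀ i ∈ s, (i : ℕ) < k)
    (hpos : ∀ x ∈ Ω, ∀ i ∈ s, 0 < x i ∧ x i < 1) (μ : Fin m → ℝ) :
    ConormalOn k Ω (fun x => ∏ i ∈ s, x i ^ μ i) fun y => ∏ i ∈ s, (y i : ℂ) ^ (μ i : ℂ) := by
  classical
  induction s using Finset.induction_on with
  | empty => simpa using ConormalOn.const 1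
  | insert a s ha ih =>
    simp only [Finset.prod_insert ha]
    have h1 : ConormalOn k Ω (fun x => x a ^ μ a) fun y => (y a : ℂ) ^ (μ a : ℂ) := by
      refine (conormalOn_logTerm (k := k) hΩ (hs a (Finset.mem_insert_self _ _))
        (fun x hx => hpos x hx a (Finset.mem_insert_self _ _)) (s := μ a) (α := μ a) (Q := 1)
        (Or.inr (by simp))).congr hΩ fun y _ => by simp [logTerm]
    exact h1.mul hΩ
      (fun x hx => Real.rpow_nonneg (hpos x hx a (Finset.mem_insert_self _ _)).1.le _)
      (ih (fun i hi => hs i (Finset.mem_insert_of_mem hi))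
        fun x hx i hi => hpos x hx i (Finset.mem_insert_of_mem hi))

theorem bDeriv_prod_cpow {s : Finset (Fin m)} {i : Fin m} (hi : i ∈ s) (hik : (i : ℕ) < k)
    {x : Fin m → ℝ} (hx : 0 < x i) (μ : Fin m → ℝ) :
    bDeriv k i (fun y => ∏ j ∈ s, (y j : ℂ) ^ (μ j : ℂ)) x =
      μ i * ∏ j ∈ s, (x j : ℂ) ^ (μ j : ℂ) := by
  classical
  have h : HasDerivAt (fun t : ℝ => ∏ j ∈ s, ((Function.update x i t j : ℝ) : ℂ) ^ (μ j : ℂ))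
      ((x i : ℂ)⁻¹ * (x i ^ (μ i : ℂ) * μ i) * ∏ j ∈ s.erase i, (x j : ℂ) ^ (μ j : ℂ)) (x i) := by
    have h1 := (hasDerivAt_logTerm (μ i : ℂ) 1 hx).mul_const
      (∏ j ∈ s.erase i, (x j : ℂ) ^ (μ j : ℂ))
    refine HasDerivAt.congr_of_eventuallyEq (by simpa using h1) ?_
    refine Filter.Eventually.of_forall fun t => ?_
    beta_reduce
    rw [← Finset.mul_prod_erase s _ hi, Function.update_self]
    congr 1
    refine Finset.prod_congr rfl fun j hj => ?_
    rw [Function.update_of_ne (Finset.ne_of_mem_erase hj)]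
  rw [bDeriv_of_hasDerivAt h, if_pos hik, ← Finset.mul_prod_erase s _ hi]
  have hx' : (x i : ℂ) ≠ 0 := by exact_mod_cast hx.ne'
  rw [Complex.real_smul]
  field_simp

/-- If `x_i` is the smallest of the coordinates `x_j ∈ (0,1)`, `j ∈ s`, then a high power of `x_i`
compensates for negative powers of the others. -/
theorem rpow_mul_prod_le {s : Finset (Fin m)} {x : Fin m → ℝ}
    (hpos : ∀ i ∈ s, 0 < x i ∧ x i < 1) {i : Fin m} (hi : i ∈ s) (hmin : ∀ j ∈ s, x i ≤ x j)
    (μ : Fin m → ℝ) (M : ℝ) :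
    x i ^ (μ i + ∑ j ∈ s.erase i, |μ j + M|) * ∏ j ∈ s.erase i, x j ^ (-M) ≤
      ∏ j ∈ s, x j ^ μ j := by
  have hi0 := (hpos i hi).1
  rw [← Finset.mul_prod_erase s _ hi, Real.rpow_add hi0, mul_assoc]
  refine mul_le_mul_of_nonneg_left ?_ (Real.rpow_nonneg hi0.le _)
  -- Each other coordinate `x_j` receives its own share `x_i ^ |μ j + M|` of the surplus power of
  -- `x_i`.
  rw [Real.rpow_sum_of_pos hi0, ← Finset.prod_mul_distrib]
  refine Finset.prod_le_prod (fun j hj => ?_) fun j hj => ?_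
  · exact mul_nonneg (Real.rpow_nonneg hi0.le _)
      (Real.rpow_nonneg (hpos j (Finset.mem_of_mem_erase hj)).1.le _)
  · have hj' := Finset.mem_of_mem_erase hj
    have hj0 := (hpos j hj').1
    calc x i ^ |μ j + M| * x j ^ (-M) ≤ x j ^ |μ j + M| * x j ^ (-M) :=
          mul_le_mul_of_nonneg_right
            (Real.rpow_le_rpow hi0.le (hmin j hj') (abs_nonneg _)) (Real.rpow_nonneg hj0.le _)
      _ ≤ x j ^ (μ j + M) * x j ^ (-M) :=
          mul_le_mul_of_nonneg_right
            (Real.rpow_le_rpow_of_exponent_ge hj0 (hpos j hj').2.le (le_abs_self _))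
            (Real.rpow_nonneg hj0.le _)
      _ = x j ^ μ j := by rw [← Real.rpow_add hj0]; congr 1; ring

/-- Approximations of `h` at each single face `x_i = 0` to arbitrary order, with losses at the other
faces, give a uniform bound near the corner. -/
theorem ConormalOn.of_faces (hΩ : IsOpen Ω) {s : Finset (Fin m)} (hs : s.Nonempty)
    (hpos : ∀ x ∈ Ω, ∀ i ∈ s, 0 < x i ∧ x i < 1) {h : (Fin m → ℝ) → ℂ}
    (hh : ContDiffOn ℝ ∞ h Ω) (μ : Fin m → ℝ) (M : ℝ)
    (H : ∀ i ∈ s, ∀ N : ℝ, ∃ S : (Fin m → ℝ) → ℂ,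
      ConormalOn k Ω (fun x => ∏ j ∈ s, x j ^ μ j) S ∧
      ConormalOn k Ω (fun x => x i ^ N * ∏ j ∈ s.erase i, x j ^ (-M)) fun y => h y - S y) :
    ConormalOn k Ω (fun x => ∏ j ∈ s, x j ^ μ j) h where
  smooth := hh
  bound l := by
    have hw : ∀ x ∈ Ω, 0 ≤ ∏ j ∈ s, x j ^ μ j := fun x hx =>
      Finset.prod_nonneg fun j hj => Real.rpow_nonneg (hpos x hx j hj).1.le _
    -- The set where `x_i` is the smallest coordinate is treated separately for each `i`. There the
    -- order `N` from `rpow_mul_prod_le` makes the remainder at this face as small as the target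
    -- weight. These finitely many sets cover `Ω`.
    have key : ∀ i ∈ s, ∃ C : ℝ, ∀ x ∈ Ω, (∀ j ∈ s, x i ≤ x j) →
        ‖bDerivs k l h x‖ ≤ C * ∏ j ∈ s, x j ^ μ j := by
      intro i hi
      obtain ⟨S, hS, hR⟩ := H i hi (μ i + ∑ j ∈ s.erase i, |μ j + M|)
      obtain ⟨C, hC⟩ := hS.bound l
      obtain ⟨C', hC'⟩ := hR.bound l
      refine ⟨C + |C'|, fun x hx hmin => ?_⟩
      have h1 : Set.EqOn h (fun y => S y + (h y - S y)) Ω := fun y _ => by ring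
      rw [bDerivs_congr hΩ h1 l hx, bDerivs_add hΩ hS.smooth hR.smooth l hx, add_mul]
      refine (norm_add_le _ _).trans (add_le_add (hC x hx) ((hC' x hx).trans ?_))
      have h2 := rpow_mul_prod_le (hpos x hx) hi hmin μ M
      have h3 : 0 ≤ x i ^ (μ i + ∑ j ∈ s.erase i, |μ j + M|) * ∏ j ∈ s.erase i, x j ^ (-M) :=
        mul_nonneg (Real.rpow_nonneg (hpos x hx i hi).1.le _) (Finset.prod_nonneg fun j hj =>
          Real.rpow_nonneg (hpos x hx j (Finset.mem_of_mem_erase hj)).1.le _)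
      exact (mul_le_mul_of_nonneg_right (le_abs_self C') h3).trans
        (mul_le_mul_of_nonneg_left h2 (abs_nonneg _))
    choose! C hC using key
    refine ⟨∑ i ∈ s, |C i|, fun x hx => ?_⟩
    obtain ⟨i, hi, hmin⟩ := s.exists_min_image x hs
    refine (hC i hi x hx hmin).trans (mul_le_mul_of_nonneg_right ?_ (hw x hx))
    exact (le_abs_self _).trans
      (Finset.single_le_sum (f := fun i => |C i|) (fun _ _ => abs_nonneg _) hi)

end Monomial

/-! ### Bounds for the coefficients of a polyhomogeneous expansion -/

section PosBall

variable {m k : ℕ} {u x : Fin m → ℝ} {r : ℝ}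

theorem mem_zeroFaces {i : Fin m} : i ∈ zeroFaces k u ↔ (i : ℕ) < k ∧ u i = 0 := by
  simp [zeroFaces]

/-- The part of a ball on which all boundary coordinates are positive. -/
def posBall (k : ℕ) (u : Fin m → ℝ) (r : ℝ) : Set (Fin m → ℝ) :=
  {x | x ∈ Metric.ball u r ∧ ∀ i : Fin m, (i : ℕ) < k → 0 < x i}

theorem isOpen_setOf_pos (m k : ℕ) : IsOpen {x : Fin m → ℝ | ∀ i : Fin m, (i : ℕ) < k → 0 < x i} := by
  simp only [Set.ofPred_forall]
  exact isOpen_iInter_of_finite fun i => isOpen_iInter_of_finite fun _ =>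
    isOpen_lt continuous_const (continuous_apply i)

theorem isOpen_posBall : IsOpen (posBall k u r) :=
  Metric.isOpen_ball.inter (isOpen_setOf_pos m k)

theorem posBall_mono {r' : ℝ} (h : r ≤ r') : posBall k u r ⊆ posBall k u r' :=
  fun _ hx => ⟨Metric.ball_subset_ball h hx.1, hx.2⟩

theorem abs_sub_lt_of_mem_ball (hx : x ∈ Metric.ball u r) (i : Fin m) : |x i - u i| < r := by
  rw [← Real.dist_eq]
  exact (dist_le_pi_dist x u i).trans_lt hx

theorem posBall_zeroFaces (hr : r ≤ 1) (hx : x ∈ posBall k u r) {i : Fin m}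
    (hi : i ∈ zeroFaces k u) : 0 < x i ∧ x i < 1 := by
  rw [mem_zeroFaces] at hi
  have h := abs_sub_lt_of_mem_ball hx.1 i
  rw [hi.2, sub_zero] at h
  exact ⟨hx.2 i hi.1, ((le_abs_self _).trans_lt h).trans_le hr⟩

end PosBall

namespace PhgExpansion

variable {m k : ℕ} {U : Set (Fin m → ℝ)} {h : (Fin m → ℝ) → ℝ} {u : Fin m → ℝ}

/-- Radii of neighbourhoods of `u` in which the estimates of the expansion are uniform. -/
structure IsSmallRadius (P : PhgExpansion k U h u) (r : ℝ) : Prop where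
  pos : 0 < r
  lt : r < P.ε
  le_one : r ≤ 1
  lt_coord : ∀ i : Fin m, (i : ℕ) < k → i ∉ zeroFaces k u → r < u i

/-- All nonzero coefficients of the expansion near `u` belong to terms of order `x_i ^ (lam i)`, or
of higher order, at each face `x_i = 0`. -/
def Dominates (P : PhgExpansion k U h u) (r : ℝ) (lam : Fin m → ℝ) : Prop :=
  ∀ I ⊆ zeroFaces k u, ∀ ι : Fin m → ℂ × ℕ, (∀ j ∈ I, ι j ∈ P.E j) → ∀ x ∈ posBall k u r,
    P.G I ι x ≠ 0 → ∀ i ∈ I, ((lam i : ℂ) = (ι i).1 ∧ (ι i).2 = 0) ∨ lam i < (ι i).1.re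

variable {P : PhgExpansion k U h u} {r : ℝ} {lam : Fin m → ℝ}

theorem smooth_coeff (hr : P.IsSmallRadius r) {I : Finset (Fin m)} (hI : I ⊆ zeroFaces k u)
    {ι : Fin m → ℂ × ℕ} (hι : ∀ j ∈ I, ι j ∈ P.E j) :
    ContDiffOn ℝ ∞ (P.G I ι) (posBall k u r) :=
  (P.G_smooth I hI ι hι).mono (posBall_mono hr.lt.le)

theorem indepOf_coeff (P : PhgExpansion k U h u) (I : Finset (Fin m)) (ι : Fin m → ℂ × ℕ) :
    IndepOf I (P.G I ι) := P.G_const I ι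

/-- The full coefficient does not depend on the coordinates that vanish at `u`, so these may be
replaced by `r`. This moves every point into a compact set on which all boundary coordinates are
positive, and there the smooth coefficient has bounded b-derivatives. -/
theorem conormalOn_coeff_zeroFaces (hr : P.IsSmallRadius r) {ι : Fin m → ℂ × ℕ}
    (hι : ∀ j ∈ zeroFaces k u, ι j ∈ P.E j) :
    ConormalOn k (posBall k u r) (fun _ => 1) (P.G (zeroFaces k u) ι) where
  smooth := smooth_coeff hr subset_rfl hι
  bound l := by
    set K : Set (Fin m → ℝ) := Metric.closedBall u r ∩ {x | ∀ j ∈ zeroFaces k u, x j = r} with hK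
    have hKc : IsCompact K := by
      refine (isCompact_closedBall u r).inter_right ?_
      simp only [Set.ofPred_forall]
      exact isClosed_iInter fun j => isClosed_iInter fun _ =>
        isClosed_eq (continuous_apply j) continuous_const
    have hKsub : K ⊆ posBall k u P.ε := by
      rintro x ⟨hx, hxZ⟩
      refine ⟨Metric.closedBall_subset_ball hr.lt hx, fun i hi => ?_⟩
      by_cases hiZ : i ∈ zeroFaces k u
      · rw [hxZ i hiZ]; exact hr.pos
      · have h1 : |x i - u i| ≤ r := by
          rw [← Real.dist_eq]; exact (dist_le_pi_dist x u i).trans hx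
        have h2 := hr.lt_coord i hi hiZ
        linarith [(abs_le.1 h1).1]
    have hc : ContinuousOn (bDerivs k l (P.G (zeroFaces k u) ι)) K :=
      ((contDiffOn_bDerivs isOpen_posBall (P.G_smooth _ subset_rfl ι hι) l).continuousOn).mono hKsub
    obtain ⟨C, hC⟩ := hKc.exists_bound_of_continuousOn hc
    refine ⟨C, fun x hx => ?_⟩
    have hx' : (fun j => if j ∈ zeroFaces k u then r else x j) ∈ K := by
      refine ⟨?_, fun j hj => by simp [hj]⟩
      rw [Metric.mem_closedBall, dist_pi_le_iff hr.pos.le]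
      intro j
      rw [Real.dist_eq]
      by_cases hj : j ∈ zeroFaces k u
      · simp [hj, (mem_zeroFaces.1 hj).2, abs_of_pos hr.pos]
      · simpa [hj] using (abs_sub_lt_of_mem_ball hx.1 j).le
    rw [mul_one, ((P.indepOf_coeff _ ι).bDerivs l) x _ fun j hj => (if_neg hj).symm]
    exact hC _ hx'

/-- The remainder of the expansion of the coefficient `G I ι` at the face `x_i = 0`. -/
theorem conormalOn_remainder (hr : P.IsSmallRadius r) {I : Finset (Fin m)}
    (hI : I ⊆ zeroFaces k u) {ι : Fin m → ℂ × ℕ} (hι : ∀ j ∈ I, ι j ∈ P.E j) {i : Fin m}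
    (hi : i ∈ zeroFaces k u \ I) (N : ℝ) :
    ConormalOn k (posBall k u r)
      (fun x => x i ^ N * ∏ j ∈ (zeroFaces k u \ I).erase i, x j ^ (-P.M))
      (fun y => P.G I ι y - ∑ p ∈ (P.E_finite i N).toFinset,
        P.G (insert i I) (Function.update ι i p) y * logTerm i p.1 (Polynomial.X ^ p.2) y) := by
  classical
  obtain ⟨hiZ, hiI⟩ := Finset.mem_sdiff.1 hi
  refine ⟨(smooth_coeff hr hI hι).sub (ContDiffOn.sum fun p hp => ?_), fun l => ?_⟩
  · have hp' : p ∈ P.E i := ((P.E_finite i N).mem_toFinset.1 hp).1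
    refine (smooth_coeff hr (Finset.insert_subset hiZ hI) ?_).mul
      (contDiffOn_logTerm (fun x hx => (posBall_zeroFaces hr.le_one hx hiZ).1) _ _)
    intro j hj
    by_cases hji : j = i
    · subst hji; simpa using hp'
    · rw [Function.update_of_ne hji]; exact hι j (Finset.mem_of_mem_insert_of_ne hj hji)
  · obtain ⟨C, hC⟩ := P.remainder I hI i hiZ hiI ι hι N l
    refine ⟨C, fun x hx => ?_⟩
    have := hC x (posBall_mono hr.lt.le hx).1 hx.2
    rw [Finset.sdiff_insert, mul_assoc] at this
    simpa only [logTerm_X_pow] using this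

theorem update_mem_E {I : Finset (Fin m)} {ι : Fin m → ℂ × ℕ} (hι : ∀ j ∈ I, ι j ∈ P.E j)
    {i : Fin m} {p : ℂ × ℕ} (hp : p ∈ P.E i) :
    ∀ j ∈ insert i I, Function.update ι i p j ∈ P.E j := by
  intro j hj
  by_cases hji : j = i
  · subst hji; simpa using hp
  · rw [Function.update_of_ne hji]; exact hι j (Finset.mem_of_mem_insert_of_ne hj hji)

theorem prod_rpow_nonneg (hr : P.IsSmallRadius r) {s : Finset (Fin m)} (hs : s ⊆ zeroFaces k u)
    (μ : Fin m → ℝ) : ∀ x ∈ posBall k u r, 0 ≤ ∏ j ∈ s, x j ^ μ j := fun _ hx =>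
  Finset.prod_nonneg fun _ hj =>
    Real.rpow_nonneg (posBall_zeroFaces hr.le_one hx (hs hj)).1.le _

/-- The coefficient of an expansion term that does not vanish identically near `u` determines an
exponent that is bounded below by `lam`; other terms vanish. -/
theorem Dominates.eq_zero_or (hd : P.Dominates r lam) {I : Finset (Fin m)}
    (hI : I ⊆ zeroFaces k u) {ι : Fin m → ℂ × ℕ} (hι : ∀ j ∈ I, ι j ∈ P.E j) {i : Fin m}
    (hi : i ∈ zeroFaces k u) {p : ℂ × ℕ} (hp : p ∈ P.E i) :
    (∀ x ∈ posBall k u r, P.G (insert i I) (Function.update ι i p) x = 0) ∨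
      (((lam i : ℂ) = p.1 ∧ p.2 = 0) ∨ lam i < p.1.re) := by
  by_cases h0 : ∀ x ∈ posBall k u r, P.G (insert i I) (Function.update ι i p) x = 0
  · exact Or.inl h0
  · push Not at h0
    obtain ⟨x, hx, hne⟩ := h0
    right
    simpa using hd (insert i I) (Finset.insert_subset hi hI) _ (update_mem_E hι hp) x hx hne i
      (Finset.mem_insert_self _ _)

/-- Induction on the number of faces in `Z \ I`. In the expansion at a further face `i`, a term
either vanishes or has a coefficient bounded by induction and a factor `x_i ^ α log ^ b x_i = O(x_i
^ lam i)`. The remainders are handled by `ConormalOn.of_faces`. -/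
theorem conormalOn_coeff (hr : P.IsSmallRadius r) (hd : P.Dominates r lam) {I : Finset (Fin m)}
    (hI : I ⊆ zeroFaces k u) {ι : Fin m → ℂ × ℕ} (hι : ∀ j ∈ I, ι j ∈ P.E j) :
    ConormalOn k (posBall k u r) (fun x => ∏ j ∈ zeroFaces k u \ I, x j ^ lam j) (P.G I ι) := by
  induction hn : (zeroFaces k u \ I).card generalizing I ι with
  | zero =>
    have h0 : zeroFaces k u \ I = ∅ := Finset.card_eq_zero.1 hn
    have : I = zeroFaces k u := hI.antisymm (Finset.sdiff_eq_empty_iff_subset.1 h0)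
    subst this
    simpa using conormalOn_coeff_zeroFaces hr hι
  | succ n ih =>
    have hne : (zeroFaces k u \ I).Nonempty := Finset.card_pos.1 (by omega)
    refine ConormalOn.of_faces isOpen_posBall hne
      (fun x hx i hi => posBall_zeroFaces hr.le_one hx (Finset.sdiff_subset hi))
      (smooth_coeff hr hI hι) lam P.M fun i hi N => ⟨_, ?_, conormalOn_remainder hr hI hι hi N⟩
    obtain ⟨hiZ, hiI⟩ := Finset.mem_sdiff.1 hi
    refine ConormalOn.sum isOpen_posBall _ fun p hp => ?_
    have hp' : p ∈ P.E i := ((P.E_finite i N).mem_toFinset.1 hp).1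
    rcases hd.eq_zero_or hI hι hiZ hp' with h0 | hgood
    · exact ConormalOn.zero.congr isOpen_posBall fun x hx => by simp [h0 x hx]
    · have hcard : (zeroFaces k u \ insert i I).card = n := by
        rw [Finset.sdiff_insert, Finset.card_erase_of_mem hi, hn]; rfl
      have h1 := ih (Finset.insert_subset hiZ hI) (update_mem_E hι hp') hcard
      have h2 : ConormalOn k (posBall k u r) (fun x => x i ^ lam i)
          (logTerm i p.1 (Polynomial.X ^ p.2)) := by
        refine conormalOn_logTerm isOpen_posBall (mem_zeroFaces.1 hiZ).1
          (fun x hx => posBall_zeroFaces hr.le_one hx hiZ) ?_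
        rcases hgood with ⟨h3, h4⟩ | h3
        · exact Or.inr ⟨by rw [← h3, Complex.ofReal_re], by simp [h4]⟩
        · exact Or.inl h3
      refine (h1.mul isOpen_posBall (prod_rpow_nonneg hr Finset.sdiff_subset _)
        h2).weight_congr fun x _ => ?_
      rw [Finset.sdiff_insert, Finset.prod_erase_mul _ _ hi]

/-- Only finitely many exponents have real part at most `lam i + 1`, so there is a least one above
`lam i`, if any lies in this range. -/
theorem exists_gap (P : PhgExpansion k U h u) (lam : Fin m → ℝ) (i : Fin m) :
    ∃ δ > 0, ∀ p ∈ P.E i, lam i < p.1.re → lam i + δ < p.1.re := by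
  have hfin := P.E_finite i (lam i + 1)
  set s := hfin.toFinset.filter fun p => lam i < p.1.re
  by_cases hs : s.Nonempty
  · obtain ⟨q, hq, hmin⟩ := s.exists_min_image (fun p => p.1.re) hs
    have hq' := (Finset.mem_filter.1 hq).2
    -- Half of the gap keeps the inequality strict, which leaves room to absorb logarithms; `1 / 2`
    -- takes care of the exponents beyond `lam i + 1`.
    refine ⟨min (1 / 2) ((q.1.re - lam i) / 2), by
      apply lt_min (by norm_num); linarith, fun p hp hlt => ?_⟩
    by_cases hp1 : p.1.re ≤ lam i + 1
    · have : q.1.re ≤ p.1.re := hmin p (Finset.mem_filter.2 ⟨hfin.mem_toFinset.2 ⟨hp, hp1⟩, hlt⟩)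
      have := min_le_right (1 / 2) ((q.1.re - lam i) / 2)
      linarith
    · have := min_le_left (1 / 2) ((q.1.re - lam i) / 2)
      linarith
  · refine ⟨1, one_pos, fun p hp hlt => ?_⟩
    by_contra hcon
    exact hs ⟨p, Finset.mem_filter.2 ⟨hfin.mem_toFinset.2 ⟨hp, not_lt.1 hcon⟩, hlt⟩⟩

/-- The leading term `x_i ^ (lam i)` is annihilated by `x_i ∂/∂x_i - lam i`. -/
theorem conormalOn_bDeriv_logTerm_sub (hr : P.IsSmallRadius r) {i : Fin m}
    (hi : i ∈ zeroFaces k u) {δ : ℝ}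
    (hδ : ∀ p ∈ P.E i, lam i < p.1.re → lam i + δ < p.1.re) {p : ℂ × ℕ} (hp : p ∈ P.E i)
    (hgood : ((lam i : ℂ) = p.1 ∧ p.2 = 0) ∨ lam i < p.1.re) :
    ConormalOn k (posBall k u r) (fun x => x i ^ (lam i + δ)) fun y =>
      bDeriv k i (logTerm i p.1 (Polynomial.X ^ p.2)) y -
        lam i * logTerm i p.1 (Polynomial.X ^ p.2) y := by
  have hik := (mem_zeroFaces.1 hi).1
  rcases hgood with ⟨h1, h2⟩ | h1
  · refine ConormalOn.zero.congr isOpen_posBall fun x hx => ?_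
    rw [bDeriv_logTerm hik _ _ (posBall_zeroFaces hr.le_one hx hi).1, h1, h2]
    simp [logTerm, mul_comm]
  · have h2 : ConormalOn k (posBall k u r) (fun x => x i ^ (lam i + δ))
        (logTerm i p.1 (Polynomial.X ^ p.2)) :=
      conormalOn_logTerm isOpen_posBall hik
        (fun x hx => posBall_zeroFaces hr.le_one hx hi) (Or.inl (hδ p hp h1))
    exact (h2.bDeriv isOpen_posBall i).sub isOpen_posBall (h2.const_mul isOpen_posBall _)

theorem bDeriv_sum_mul {ι : Type*} {s : Finset ι} {F T : ι → (Fin m → ℝ) → ℂ} {x : Fin m → ℝ}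
    (hF : ∀ p ∈ s, DifferentiableAt ℝ (F p) x) (hT : ∀ p ∈ s, DifferentiableAt ℝ (T p) x)
    (i : Fin m) :
    bDeriv k i (fun y => ∑ p ∈ s, F p y * T p y) x =
      ∑ p ∈ s, (bDeriv k i (F p) x * T p x + F p x * bDeriv k i (T p) x) := by
  have h1 : HasDerivAt (fun t : ℝ => ∑ p ∈ s, F p (Function.update x i t) *
      T p (Function.update x i t)) _ (x i) := HasDerivAt.fun_sum fun p hp =>
    (hasDerivAt_line (hF p hp) i).fun_mul (hasDerivAt_line (hT p hp) i)
  rw [bDeriv_of_hasDerivAt h1, Finset.smul_sum]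
  refine Finset.sum_congr rfl fun p hp => ?_
  rw [bDeriv_eq_fderiv (hF p hp), bDeriv_eq_fderiv (hT p hp)]
  simp only [Function.update_eq_self, smul_add, smul_mul_assoc, mul_smul_comm]

/-- `x_i ∂/∂x_i - lam i` improves the order of vanishing at the face `x_i = 0`. -/
theorem conormalOn_bDeriv_coeff_sub (hr : P.IsSmallRadius r) (hd : P.Dominates r lam)
    {i : Fin m} {δ : ℝ} (hδ : ∀ p ∈ P.E i, lam i < p.1.re → lam i + δ < p.1.re)
    {I : Finset (Fin m)} (hI : I ⊆ zeroFaces k u) (hi : i ∈ zeroFaces k u \ I)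
    {ι : Fin m → ℂ × ℕ} (hι : ∀ j ∈ I, ι j ∈ P.E j) :
    ConormalOn k (posBall k u r)
      (fun x => ∏ j ∈ zeroFaces k u \ I, x j ^ Function.update lam i (lam i + δ) j)
      (fun y => bDeriv k i (P.G I ι) y - lam i * P.G I ι y) := by
  induction hn : (zeroFaces k u \ I).card generalizing I ι with
  | zero => rw [Finset.card_eq_zero.1 hn] at hi; simp at hi
  | succ n ih =>
    have hO : IsOpen (posBall k u r) := isOpen_posBall
    have hsm := smooth_coeff hr hI hι
    refine ConormalOn.of_faces hO ⟨i, hi⟩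
      (fun x hx i hi => posBall_zeroFaces hr.le_one hx (Finset.sdiff_subset hi))
      ((contDiffOn_bDeriv hO hsm i).sub (contDiffOn_const.mul hsm)) _ P.M fun j hj N => ?_
    obtain ⟨hjZ, hjI⟩ := Finset.mem_sdiff.1 hj
    have hjk := (mem_zeroFaces.1 hjZ).1
    have hR := conormalOn_remainder hr hI hι hj N
    set s := (P.E_finite j N).toFinset
    have hs : ∀ p ∈ s, p ∈ P.E j := fun p hp => ((P.E_finite j N).mem_toFinset.1 hp).1
    set F : ℂ × ℕ → (Fin m → ℝ) → ℂ := fun p => P.G (insert j I) (Function.update ι j p)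
    set T : ℂ × ℕ → (Fin m → ℝ) → ℂ := fun p => logTerm j p.1 (Polynomial.X ^ p.2)
    have hFs : ∀ p ∈ s, ContDiffOn ℝ ∞ (F p) (posBall k u r) := fun p hp =>
      smooth_coeff hr (Finset.insert_subset hjZ hI) (update_mem_E hι (hs p hp))
    have hTs : ∀ p, ContDiffOn ℝ ∞ (T p) (posBall k u r) := fun p =>
      contDiffOn_logTerm (fun x hx => (posBall_zeroFaces hr.le_one hx hjZ).1) _ _
    have hSs : ContDiffOn ℝ ∞ (fun y => ∑ p ∈ s, F p y * T p y) (posBall k u r) :=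
      ContDiffOn.sum fun p hp => (hFs p hp).mul (hTs p)
    have hR' : ConormalOn k (posBall k u r) _ _ :=
      (hR.bDeriv hO i).sub hO (hR.const_mul hO (lam i))
    -- The approximation at the face `j` is `x_i ∂/∂x_i - lam i` applied to the partial sum,
    -- expanded by the product rule. The remainder keeps its weight under this operator.
    refine ⟨fun y => ∑ p ∈ s, ((bDeriv k i (F p) y * T p y + F p y * bDeriv k i (T p) y) -
      lam i * (F p y * T p y)), ?_, hR'.congr hO fun x hx => ?_⟩
    · refine ConormalOn.sum hO _ fun p hp => ?_
      rcases hd.eq_zero_or hI hι hjZ (hs p hp) with h0 | hgood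
      · refine ConormalOn.zero.congr hO fun x hx => ?_
        have h0' : Set.EqOn (F p) (fun _ => 0) (posBall k u r) := h0
        have : bDeriv k i (F p) x = 0 := by
          rw [bDeriv_congr hO h0' i hx]; simp [bDeriv]
        simp [this, h0' hx]
      · have hjs := Finset.insert_subset hjZ hI
        have hE := update_mem_E hι (hs p hp)
        by_cases hij : i = j
        -- At the face `i` itself the coefficients do not depend on `x_i`. The operator acts on the
        -- log terms only, and the gain comes from there.
        · subst hij
          have h1 := conormalOn_coeff hr hd hjs hE
          have h2 := conormalOn_bDeriv_logTerm_sub hr hjZ hδ (hs p hp) hgood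
          refine ((h1.mul hO (prod_rpow_nonneg hr Finset.sdiff_subset _) h2).weight_congr
            fun x _ => ?_).congr hO fun x _ => ?_
          · rw [Finset.sdiff_insert, ← Finset.prod_erase_mul _ _ hi, Function.update_self]
            congr 1
            refine Finset.prod_congr rfl fun a ha => ?_
            rw [Function.update_of_ne (Finset.ne_of_mem_erase ha)]
          · have : bDeriv k i (F p) x = 0 :=
              (P.indepOf_coeff _ _).bDeriv_eq_zero (Finset.mem_insert_self _ _)
            rw [this]
            ring
        -- At another face the log term does not depend on `x_i`. The operator acts on the
        -- coefficient, for which `i` is still an unused face, so the induction hypothesis supplies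
        -- the gain.
        · have hcard : (zeroFaces k u \ insert j I).card = n := by
            rw [Finset.sdiff_insert, Finset.card_erase_of_mem hj, hn]; rfl
          have hi' : i ∈ zeroFaces k u \ insert j I := by
            rw [Finset.sdiff_insert]; exact Finset.mem_erase.2 ⟨hij, hi⟩
          have h1 := ih hjs hi' hE hcard
          have h2 : ConormalOn k (posBall k u r) (fun x => x j ^ lam j) (T p) := by
            refine conormalOn_logTerm hO hjk
              (fun x hx => posBall_zeroFaces hr.le_one hx hjZ) ?_
            rcases hgood with ⟨h3, h4⟩ | h3
            · exact Or.inr ⟨by rw [← h3, Complex.ofReal_re], by simp [h4]⟩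
            · exact Or.inl h3
          refine ((h1.mul hO (prod_rpow_nonneg hr Finset.sdiff_subset _) h2).weight_congr
            fun x _ => ?_).congr hO fun x _ => ?_
          · rw [Finset.sdiff_insert, ← Finset.prod_erase_mul _ _ hj,
              Function.update_of_ne (Ne.symm hij)]
          · have : bDeriv k i (T p) x = 0 := bDeriv_logTerm_of_ne hij _ _ x
            rw [this]
            ring
    · have hx1 := hsm.differentiableAt_of_isOpen hO hx
      have hx2 := hSs.differentiableAt_of_isOpen hO hx
      have h1 : bDeriv k i (fun y => P.G I ι y - ∑ p ∈ s, F p y * T p y) x =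
          bDeriv k i (P.G I ι) x - bDeriv k i (fun y => ∑ p ∈ s, F p y * T p y) x := by
        rw [bDeriv_of_hasDerivAt ((hasDerivAt_line hx1 i).fun_sub (hasDerivAt_line hx2 i)),
          bDeriv_eq_fderiv hx1, bDeriv_eq_fderiv hx2, smul_sub]
      have h2 := bDeriv_sum_mul (k := k)
        (fun p hp => (hFs p hp).differentiableAt_of_isOpen hO hx)
        (fun p _ => (hTs p).differentiableAt_of_isOpen hO hx) i
      beta_reduce
      rw [h1, h2, Finset.sum_sub_distrib, ← Finset.mul_sum]
      ring

/-- After division by its leading monomial, a polyhomogeneous function is bounded near `u` with all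
its b-derivatives, and its b-derivatives decay at the faces. -/
theorem quotient_bounds (hr : P.IsSmallRadius r) (hd : P.Dominates r lam)
    (hh : ContDiffOn ℝ ∞ h (posBall k u r)) :
    ContDiffOn ℝ ∞ (fun x => h x * ∏ j ∈ zeroFaces k u, x j ^ (-lam j)) (posBall k u r) ∧
    (∀ l : List (Fin m), ∃ C : ℝ, ∀ x ∈ posBall k u r,
      |bDerivs k l (fun x => h x * ∏ j ∈ zeroFaces k u, x j ^ (-lam j)) x| ≤ C) ∧
    ∀ i ∈ zeroFaces k u, ∃ δ : ℝ, δ > 0 ∧ ∀ l : List (Fin m), ∃ C : ℝ, ∀ x ∈ posBall k u r,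
      |bDerivs k (i :: l) (fun x => h x * ∏ j ∈ zeroFaces k u, x j ^ (-lam j)) x| ≤
        C * x i ^ δ := by
  set f : (Fin m → ℝ) → ℝ := fun x => h x * ∏ j ∈ zeroFaces k u, x j ^ (-lam j) with hf
  have hO : IsOpen (posBall k u r) := isOpen_posBall
  have hpos : ∀ x ∈ posBall k u r, ∀ j ∈ zeroFaces k u, 0 < x j ∧ x j < 1 :=
    fun x hx j hj => posBall_zeroFaces hr.le_one hx hj
  have hfs : ContDiffOn ℝ ∞ f (posBall k u r) := by
    refine hh.mul (contDiffOn_prod fun j hj => ?_)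
    exact (contDiff_apply ℝ ℝ j).contDiffOn.rpow_const_of_ne fun x hx => (hpos x hx j hj).1.ne'
  -- Any value serves here, since no index is constrained for `I = ∅`.
  set ι : Fin m → ℂ × ℕ := fun _ => (0, 0)
  have hι : ∀ j ∈ (∅ : Finset (Fin m)), ι j ∈ P.E j := by simp
  set g : (Fin m → ℝ) → ℂ := P.G ∅ ι
  set q : (Fin m → ℝ) → ℂ := fun y => ∏ j ∈ zeroFaces k u, (y j : ℂ) ^ (((-lam j : ℝ)) : ℂ)
  have hq : ConormalOn k (posBall k u r) _ q :=
    conormalOn_prod_cpow hO (fun i hi => (mem_zeroFaces.1 hi).1) hpos fun j => -lam j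
  have hg : ConormalOn k (posBall k u r) _ g := conormalOn_coeff hr hd (Finset.empty_subset _) hι
  have hfg : Set.EqOn (fun y => (f y : ℂ)) (fun y => g y * q y) (posBall k u r) := by
    intro x hx
    have h1 : g x = (h x : ℂ) := P.G_empty ι x (posBall_mono hr.lt.le hx).1 hx.2
    simp only [hf, q, h1, Complex.ofReal_mul, Complex.ofReal_prod]
    congr 1
    exact Finset.prod_congr rfl fun j hj => Complex.ofReal_cpow (hpos x hx j hj).1.le _
  have hw : ∀ x ∈ posBall k u r, 0 ≤ ∏ j ∈ zeroFaces k u \ ∅, x j ^ lam j :=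
    prod_rpow_nonneg hr Finset.sdiff_subset _
  have hcancel : ∀ x ∈ posBall k u r, (∏ j ∈ zeroFaces k u, x j ^ lam j) *
      ∏ j ∈ zeroFaces k u, x j ^ (-lam j) = 1 := by
    intro x hx
    rw [← Finset.prod_mul_distrib]
    refine Finset.prod_eq_one fun j hj => ?_
    rw [← Real.rpow_add (hpos x hx j hj).1, add_neg_cancel, Real.rpow_zero]
  refine ⟨hfs, fun l => ?_, fun i hi => ?_⟩
  · obtain ⟨C, hC⟩ := (hg.mul hO hw hq).bound l
    refine ⟨C, fun x hx => ?_⟩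
    have h1 := hC x hx
    rw [← bDerivs_congr hO hfg l hx, bDerivs_ofReal hO hfs l hx, Complex.norm_real,
      Finset.sdiff_empty, hcancel x hx, mul_one] at h1
    exact h1
  · obtain ⟨δ, hδ0, hδ⟩ := P.exists_gap lam i
    refine ⟨δ, hδ0, fun l => ?_⟩
    have hB := conormalOn_bDeriv_coeff_sub hr hd hδ (Finset.empty_subset _)
      (by simpa using hi) hι
    obtain ⟨C, hC⟩ := (hB.mul hO (prod_rpow_nonneg hr Finset.sdiff_subset _) hq).bound l
    refine ⟨C, fun x hx => ?_⟩
    have h1 := hC x hx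
    -- Since `x_i ∂/∂x_i` multiplies the monomial `q` by `-lam i`, the product rule turns `x_i
    -- ∂/∂x_i` on `g q` into `x_i ∂/∂x_i - lam i` on `g`.
    have h2 : Set.EqOn (bDeriv k i fun y => (f y : ℂ))
        (fun y => (bDeriv k i (P.G ∅ ι) y - lam i * P.G ∅ ι y) * q y) (posBall k u r) := by
      intro y hy
      rw [bDeriv_congr hO hfg i hy, bDeriv_mul (hg.smooth.differentiableAt_of_isOpen hO hy)
        (hq.smooth.differentiableAt_of_isOpen hO hy),
        bDeriv_prod_cpow hi (mem_zeroFaces.1 hi).1 (hpos y hy i hi).1 fun j => -lam j]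
      simp only [Complex.ofReal_neg, g, q]
      ring
    have h3 : ContDiffOn ℝ ∞ (fun y => (f y : ℂ)) (posBall k u r) :=
      Complex.ofRealCLM.contDiff.comp_contDiffOn hfs
    rw [← bDerivs_congr hO h2 l hx, bDerivs_bDeriv_comm hO h3 i l hx, ← bDerivs_cons,
      bDerivs_ofReal hO hfs (i :: l) hx, Complex.norm_real, Finset.sdiff_empty] at h1
    refine h1.trans_eq ?_
    congr 1
    have h4 : ∏ j ∈ zeroFaces k u, x j ^ Function.update lam i (lam i + δ) j =
        x i ^ δ * ∏ j ∈ zeroFaces k u, x j ^ lam j := by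
      rw [← Finset.mul_prod_erase _ _ hi, ← Finset.mul_prod_erase _ (fun j => x j ^ lam j) hi,
        Function.update_self, Real.rpow_add (hpos x hx i hi).1]
      have : ∏ j ∈ (zeroFaces k u).erase i, x j ^ Function.update lam i (lam i + δ) j =
          ∏ j ∈ (zeroFaces k u).erase i, x j ^ lam j :=
        Finset.prod_congr rfl fun j hj => by
          rw [Function.update_of_ne (Finset.ne_of_mem_erase hj)]
      rw [this]
      ring
    rw [h4, mul_assoc, hcancel x hx, mul_one]

end PhgExpansion

/-! ### Relatively open subsets of the local models -/

section RelOpen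

variable {m k : ℕ} {E : Type*} [NormedAddCommGroup E] [NormedSpace ℝ E]
  {U : Set (Fin m → ℝ)} {x : Fin m → ℝ}

/-- Relatively open subsets of `corner m k`. -/
def RelOpen (k : ℕ) (U : Set (Fin m → ℝ)) : Prop :=
  ∃ O : Set (Fin m → ℝ), IsOpen O ∧ U = O ∩ corner m k

theorem RelOpen.subset_corner (hU : RelOpen k U) : U ⊆ corner m k := by
  obtain ⟨O, -, rfl⟩ := hU
  exact Set.inter_subset_right

theorem RelOpen.inter (hU : RelOpen k U) {O : Set (Fin m → ℝ)} (hO : IsOpen O) :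
    RelOpen k (U ∩ O) := by
  obtain ⟨O', hO', rfl⟩ := hU
  exact ⟨O' ∩ O, hO'.inter hO, by ext; simp; tauto⟩

theorem relOpen_ball (k : ℕ) (u : Fin m → ℝ) (r : ℝ) :
    RelOpen k (Metric.ball u r ∩ corner m k) := ⟨_, Metric.isOpen_ball, rfl⟩

theorem RelOpen.eventually_update_mem (hU : RelOpen k U) (hx : x ∈ U) {i : Fin m}
    (hi : (i : ℕ) < k → 0 < x i) : ∀ᶠ t in 𝓝 (x i), Function.update x i t ∈ U := by
  obtain ⟨O, hO, rfl⟩ := hU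
  have h1 := ACorners.eventually_update_mem hO hx.1 i
  have h2 : ∀ᶠ t in 𝓝 (x i), (i : ℕ) < k → 0 < t := by
    by_cases h : (i : ℕ) < k
    · filter_upwards [lt_mem_nhds (hi h)] with t ht _ using ht
    · exact Filter.Eventually.of_forall fun t h' => absurd h' h
  filter_upwards [h1, h2] with t ht1 ht2
  refine ⟨ht1, fun j hj => ?_⟩
  by_cases hji : j = i
  · subst hji; simpa using (ht2 hj).le
  · rw [Function.update_of_ne hji]; exact hx.2 j hj

theorem bDeriv_eq_zero {f : (Fin m → ℝ) → E} {i : Fin m} (hi : (i : ℕ) < k) (hx : x i = 0) :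
    bDeriv k i f x = 0 := by simp [bDeriv, hi, hx]

theorem RelOpen.pos_or_eq_zero (hU : RelOpen k U) (hx : x ∈ U) (i : Fin m) :
    ((i : ℕ) < k → 0 < x i) ∨ ((i : ℕ) < k ∧ x i = 0) := by
  by_cases hi : (i : ℕ) < k
  · rcases (hU.subset_corner hx i hi).eq_or_lt with h | h
    · exact Or.inr ⟨hi, h.symm⟩
    · exact Or.inl fun _ => h
  · exact Or.inl fun h => absurd h hi

theorem RelOpen.bDeriv_congr (hU : RelOpen k U) {f h : (Fin m → ℝ) → E} (hfh : Set.EqOn f h U)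
    (i : Fin m) : Set.EqOn (bDeriv k i f) (bDeriv k i h) U := by
  intro x hx
  rcases hU.pos_or_eq_zero hx i with hpos | ⟨hi, h0⟩
  · have : (fun t : ℝ => f (Function.update x i t)) =ᶠ[𝓝 (x i)]
        fun t : ℝ => h (Function.update x i t) :=
      (hU.eventually_update_mem hx hpos).mono fun t ht => hfh ht
    simp only [bDeriv, this.deriv_eq]
  · rw [bDeriv_eq_zero hi h0, bDeriv_eq_zero hi h0]

theorem convex_corner (m k : ℕ) : Convex ℝ (corner m k) := by
  intro x hx y hy a b ha hb _ i hi
  simp only [Pi.add_apply, Pi.smul_apply, smul_eq_mul]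
  have := hx i hi
  have := hy i hi
  positivity

theorem RelOpen.uniqueDiffOn (hU : RelOpen k U) : UniqueDiffOn ℝ U := by
  obtain ⟨O, hO, rfl⟩ := hU
  rw [Set.inter_comm]
  refine (uniqueDiffOn_convex (convex_corner m k) ⟨fun _ => 1, ?_⟩).inter hO
  refine interior_maximal (t := {x : Fin m → ℝ | ∀ i : Fin m, (i : ℕ) < k → 0 < x i})
    (fun x hx i hi => (hx i hi).le) (isOpen_setOf_pos m k) fun i _ => one_pos

end RelOpen

/-! ### Smooth functions are a-smooth -/

section Smooth

variable {m k : ℕ} {U : Set (Fin m → ℝ)} {x : Fin m → ℝ} {f : (Fin m → ℝ) → ℝ}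

theorem RelOpen.hasDerivAt_line (hU : RelOpen k U) (hf : ContDiffOn ℝ ∞ f U) (hx : x ∈ U)
    {i : Fin m} (hi : (i : ℕ) < k → 0 < x i) :
    HasDerivAt (fun t : ℝ => f (Function.update x i t))
      (fderivWithin ℝ f U x (Pi.single i 1)) (x i) := by
  have h1 : HasFDerivWithinAt f (fderivWithin ℝ f U x) U (Function.update x i (x i)) := by
    simpa using ((hf.differentiableOn (by simp)) x hx).hasFDerivWithinAt
  have h2 : HasDerivWithinAt (fun t : ℝ => f (Function.update x i t)) _
      {t | Function.update x i t ∈ U} (x i) :=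
    h1.comp_hasDerivWithinAt (x i) (hasDerivAt_update x i (x i)).hasDerivWithinAt
      fun t ht => ht
  exact h2.hasDerivAt (hU.eventually_update_mem hx hi)

theorem RelOpen.bDeriv_eq (hU : RelOpen k U) (hf : ContDiffOn ℝ ∞ f U) (hx : x ∈ U) (i : Fin m) :
    bDeriv k i f x =
      (if (i : ℕ) < k then x i else 1) * fderivWithin ℝ f U x (Pi.single i 1) := by
  rcases hU.pos_or_eq_zero hx i with hpos | ⟨hi, h0⟩
  · rw [bDeriv_of_hasDerivAt (hU.hasDerivAt_line hf hx hpos), smul_eq_mul]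
  · simp [bDeriv_eq_zero hi h0, h0, hi]

theorem RelOpen.contDiffOn_partial (hU : RelOpen k U) (hf : ContDiffOn ℝ ∞ f U) (i : Fin m) :
    ContDiffOn ℝ ∞ (fun x => fderivWithin ℝ f U x (Pi.single i 1)) U :=
  (hf.fderivWithin hU.uniqueDiffOn (m := ∞) (by simp)).clm_apply contDiffOn_const

theorem RelOpen.contDiffOn_bDerivs (hU : RelOpen k U) (hf : ContDiffOn ℝ ∞ f U)
    (l : List (Fin m)) : ContDiffOn ℝ ∞ (bDerivs k l f) U := by
  induction l with
  | nil => exact hf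
  | cons i l ih =>
    exact ((contDiff_bCoeff i).contDiffOn.mul (hU.contDiffOn_partial ih i)).congr
      fun x hx => hU.bDeriv_eq ih hx i

/-- Functions that are smooth up to the boundary are a-smooth. -/
theorem RelOpen.aSmooth (hU : RelOpen k U) (hf : ContDiffOn ℝ ∞ f U) : ASmooth k U f where
  continuousOn l := (hU.contDiffOn_bDerivs hf l).continuousOn
  differentiable l _ _ hx hi :=
    (hU.hasDerivAt_line (hU.contDiffOn_bDerivs hf l) hx hi).differentiableAt
  decay l i hi S hS hSc := by
    have hl := hU.contDiffOn_bDerivs hf l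
    obtain ⟨C, hC⟩ := hSc.exists_bound_of_continuousOn
      ((hU.contDiffOn_partial hl i).continuousOn.mono hS)
    refine ⟨|C| + 1, by positivity, 1, one_pos, fun x hx => ?_⟩
    have hx0 := hU.subset_corner (hS hx) i hi
    rw [bDerivs_cons, hU.bDeriv_eq hl (hS hx), if_pos hi, abs_mul, abs_of_nonneg hx0,
      Real.rpow_one, mul_comm]
    refine mul_le_mul_of_nonneg_right ((hC x hx).trans ?_) hx0
    linarith [le_abs_self C]

end Smooth

/-! ### Extension to the boundary -/

section Extension

variable {m k : ℕ} {u x : Fin m → ℝ} {r : ℝ} {f : (Fin m → ℝ) → ℝ}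

/-- Mean value inequality against a primitive `β` of the bound. It suits bounds such as `C s ^ (δ -
1)`, which may be unbounded near `s = 0` but have a primitive continuous there. -/
theorem abs_sub_le_of_abs_deriv_le {φ φ' β β' : ℝ → ℝ} {a b : ℝ} (hab : a ≤ b)
    (hφ : ∀ s ∈ Set.Icc a b, HasDerivAt φ (φ' s) s) (hβ : ∀ s ∈ Set.Icc a b, HasDerivAt β (β' s) s)
    (hle : ∀ s ∈ Set.Icc a b, |φ' s| ≤ β' s) : |φ b - φ a| ≤ |β b - β a| := by
  have h := image_norm_le_of_norm_deriv_right_le_deriv_boundary' (a := a) (b := b)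
    (f := fun s => φ s - φ a) (f' := φ') (B := fun s => β s - β a) (B' := β')
    (fun s hs => ((hφ s hs).continuousAt.continuousWithinAt.sub continuousWithinAt_const))
    (fun s hs => ((hφ s (Set.Ico_subset_Icc_self hs)).sub_const _).hasDerivWithinAt)
    (by simp)
    (fun s hs => ((hβ s hs).continuousAt.continuousWithinAt.sub continuousWithinAt_const))
    (fun s hs => ((hβ s (Set.Ico_subset_Icc_self hs)).sub_const _).hasDerivWithinAt)
    (fun s hs => hle s (Set.Ico_subset_Icc_self hs)) (Set.right_mem_Icc.2 hab)
  exact h.trans (le_abs_self _)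

theorem posBall_coord {y : Fin m → ℝ} (hr : 0 < r) (hy : ∀ i, |y i - u i| < r)
    (hpos : ∀ i : Fin m, (i : ℕ) < k → 0 < y i) : y ∈ posBall k u r := by
  refine ⟨?_, hpos⟩
  rw [Metric.mem_ball, dist_pi_lt_iff hr]
  exact fun i => by rw [Real.dist_eq]; exact hy i

theorem posBall_piecewise {y : Fin m → ℝ} (hx : x ∈ posBall k u r) (hy : y ∈ posBall k u r)
    (s : Finset (Fin m)) : s.piecewise y x ∈ posBall k u r := by
  refine posBall_coord (dist_nonneg.trans_lt hx.1) (fun i => ?_) fun i hi => ?_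
  all_goals by_cases his : i ∈ s <;> simp only [his, Finset.piecewise_eq_of_mem,
    Finset.piecewise_eq_of_notMem, not_false_eq_true]
  · exact abs_sub_lt_of_mem_ball hy.1 i
  · exact abs_sub_lt_of_mem_ball hx.1 i
  · exact hy.2 i hi
  · exact hx.2 i hi

theorem posBall_update_uIcc {i : Fin m} {t s : ℝ} (hx : x ∈ posBall k u r)
    (ht : Function.update x i t ∈ posBall k u r) (hs : s ∈ Set.uIcc (x i) t) :
    Function.update x i s ∈ posBall k u r := by
  have h1 := abs_lt.1 (abs_sub_lt_of_mem_ball hx.1 i)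
  have h2 := abs_lt.1 (by simpa using abs_sub_lt_of_mem_ball ht.1 i : |t - u i| < r)
  refine posBall_coord (dist_nonneg.trans_lt hx.1) (fun j => ?_) fun j hj => ?_
  all_goals by_cases hji : j = i
  · subst hji
    rw [Function.update_self, abs_lt]
    rcases Set.mem_uIcc.1 hs with h | h <;> constructor <;> linarith [h.1, h.2]
  · rw [Function.update_of_ne hji]; exact abs_sub_lt_of_mem_ball hx.1 j
  · subst hji
    have h3 := hx.2 j hj
    have h4 : 0 < t := by simpa using ht.2 j hj
    rw [Function.update_self]
    rcases Set.mem_uIcc.1 hs with h | h <;> linarith [h.1, h.2]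
  · rw [Function.update_of_ne hji]; exact hx.2 j hj

/-- The increments of a smooth function are controlled coordinate by coordinate. -/
theorem abs_sub_le_sum {h : (Fin m → ℝ) → ℝ} (hh : ContDiffOn ℝ ∞ h (posBall k u r))
    {β β' : Fin m → ℝ → ℝ}
    (hβ : ∀ i, ∀ x ∈ posBall k u r, HasDerivAt (β i) (β' i (x i)) (x i))
    (hle : ∀ i, ∀ x ∈ posBall k u r, |fderiv ℝ h x (Pi.single i 1)| ≤ β' i (x i))
    {y : Fin m → ℝ} (hx : x ∈ posBall k u r) (hy : y ∈ posBall k u r) :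
    |h y - h x| ≤ ∑ i, |β i (y i) - β i (x i)| := by
  classical
  have line : ∀ z ∈ posBall k u r, ∀ (i : Fin m) (t : ℝ), Function.update z i t ∈ posBall k u r →
      |h (Function.update z i t) - h z| ≤ |β i t - β i (z i)| := by
    have aux : ∀ z ∈ posBall k u r, ∀ (i : Fin m) (t : ℝ),
        Function.update z i t ∈ posBall k u r → z i ≤ t →
        |h (Function.update z i t) - h z| ≤ |β i t - β i (z i)| := by
      intro z hz i t ht hzt
      have hmem : ∀ s ∈ Set.Icc (z i) t, Function.update z i s ∈ posBall k u r := fun s hs =>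
        posBall_update_uIcc hz ht (Set.Icc_subset_uIcc hs)
      have := abs_sub_le_of_abs_deriv_le (φ := fun s => h (Function.update z i s))
        (φ' := fun s => fderiv ℝ h (Function.update z i s) (Pi.single i 1)) (β := β i)
        (β' := β' i) hzt (fun s hs => by
          simpa using hasDerivAt_line
            (hh.differentiableAt_of_isOpen isOpen_posBall (hmem s hs)) i)
        (fun s hs => by simpa using hβ i _ (hmem s hs))
        (fun s hs => by simpa using hle i _ (hmem s hs))
      simpa using this
    intro z hz i t ht
    rcases le_total (z i) t with hzt | hzt
    · exact aux z hz i t ht hzt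
    · have := aux (Function.update z i t) ht i (z i) (by simpa using hz) (by simpa using hzt)
      rw [Function.update_idem, Function.update_eq_self, Function.update_self] at this
      rwa [abs_sub_comm, abs_sub_comm (β i t)]
  -- The path from `x` to `y` changes one coordinate at a time. It stays in the domain because balls
  -- of the sup norm are boxes and positivity is a condition on each coordinate.
  have key : ∀ s : Finset (Fin m),
      |h (s.piecewise y x) - h x| ≤ ∑ i ∈ s, |β i (y i) - β i (x i)| := by
    intro s
    induction s using Finset.induction_on with
    | empty => simp
    | insert a s ha ih =>
      have h1 := posBall_piecewise hx hy s
      have h2 := posBall_piecewise hx hy (insert a s)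
      rw [Finset.piecewise_insert] at h2 ⊢
      have h3 := line _ h1 a (y a) h2
      rw [Finset.piecewise_eq_of_notMem _ _ _ ha] at h3
      rw [Finset.sum_insert ha]
      exact (abs_sub_le _ _ _).trans (add_le_add h3 ih)
  simpa using key Finset.univ

/-- Bounds on all b-derivatives near a point, with decay at the faces. -/
structure BBounds (k : ℕ) (Ω : Set (Fin m → ℝ)) (f : (Fin m → ℝ) → ℝ) : Prop where
  smooth : ContDiffOn ℝ ∞ f Ω
  bound : ∀ l : List (Fin m), ∃ C : ℝ, ∀ x ∈ Ω, |bDerivs k l f x| ≤ C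
  decay : ∀ i : Fin m, (i : ℕ) < k → ∃ δ : ℝ, δ > 0 ∧ ∀ l : List (Fin m), ∃ C : ℝ, ∀ x ∈ Ω,
    |bDerivs k (i :: l) f x| ≤ C * x i ^ δ

/-- Increments are bounded by those of functions `β i` of single coordinates that are continuous up
to the faces, so the values near `x` form a Cauchy filter. -/
theorem BBounds.exists_tendsto (hf : BBounds k (posBall k u r) f) (l : List (Fin m))
    (hx : x ∈ closure (posBall k u r)) :
    ∃ y, Filter.Tendsto (bDerivs k l f) (𝓝[posBall k u r] x) (𝓝 y) := by
  have hl := contDiffOn_bDerivs (k := k) isOpen_posBall hf.smooth l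
  have hβ : ∀ i : Fin m, ∃ β β' : ℝ → ℝ, Continuous β ∧
      (∀ x ∈ posBall k u r, HasDerivAt β (β' (x i)) (x i)) ∧
      ∀ x ∈ posBall k u r, |fderiv ℝ (bDerivs k l f) x (Pi.single i 1)| ≤ β' (x i) := by
    intro i
    have hval : ∀ x ∈ posBall k u r, bDerivs k (i :: l) f x =
        (if (i : ℕ) < k then x i else 1) • fderiv ℝ (bDerivs k l f) x (Pi.single i 1) :=
      fun x hx => bDeriv_eq_fderiv (hl.differentiableAt_of_isOpen isOpen_posBall hx) i
    by_cases hi : (i : ℕ) < k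
    · obtain ⟨δ, hδ, h⟩ := hf.decay i hi
      obtain ⟨C, hC⟩ := h l
      -- The decay `O(x_i ^ δ)` of `x_i ∂/∂x_i` bounds `∂/∂x_i` by `C x_i ^ (δ - 1)`, and `δ > 0`
      -- makes its primitive continuous at `0`.
      refine ⟨fun s => C / δ * s ^ δ, fun s => C * s ^ (δ - 1),
        continuous_const.mul (Real.continuous_rpow_const hδ.le), fun x hx => ?_, fun x hx => ?_⟩
      · refine ((Real.hasDerivAt_rpow_const (p := δ)
          (Or.inl (hx.2 i hi).ne')).const_mul (C / δ)).congr_deriv ?_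
        field_simp
      · have h1 := hC x hx
        have h0 := hx.2 i hi
        rw [hval x hx, if_pos hi, smul_eq_mul, abs_mul, abs_of_pos h0] at h1
        beta_reduce
        rw [Real.rpow_sub_one h0.ne', ← mul_div_assoc, le_div_iff₀ h0, mul_comm]
        exact h1
    · obtain ⟨C, hC⟩ := hf.bound (i :: l)
      refine ⟨fun s => C * s, fun _ => C, by fun_prop, fun x _ => ?_, fun x hx => ?_⟩
      · simpa using (hasDerivAt_id (x i)).const_mul C
      · have h1 := hC x hx
        rwa [hval x hx, if_neg hi, one_smul] at h1
  choose β β' hβc hβd hβle using hβ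
  have := mem_closure_iff_nhdsWithin_neBot.1 hx
  have hcau : Cauchy (Filter.map (bDerivs k l f) (𝓝[posBall k u r] x)) := by
    rw [cauchy_map_iff]
    refine ⟨inferInstance, Metric.uniformity_basis_dist.tendsto_right_iff.2 fun ε hε => ?_⟩
    have hlim : Filter.Tendsto (fun p : (Fin m → ℝ) × (Fin m → ℝ) =>
        ∑ i, |β i (p.1 i) - β i (p.2 i)|) (𝓝[posBall k u r] x ×ˢ 𝓝[posBall k u r] x) (𝓝 0) := by
      have hc : Continuous fun p : (Fin m → ℝ) × (Fin m → ℝ) =>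
          ∑ i, |β i (p.1 i) - β i (p.2 i)| := by
        refine continuous_finsetSum _ fun i _ => Continuous.abs (Continuous.sub ?_ ?_)
        · exact (hβc i).comp ((continuous_apply i).comp continuous_fst)
        · exact (hβc i).comp ((continuous_apply i).comp continuous_snd)
      have := hc.tendsto (x, x)
      simp only [sub_self, abs_zero, Finset.sum_const_zero] at this
      refine this.mono_left ?_
      rw [nhds_prod_eq]
      exact Filter.prod_mono nhdsWithin_le_nhds nhdsWithin_le_nhds
    have hmem : ∀ᶠ p in 𝓝[posBall k u r] x ×ˢ 𝓝[posBall k u r] x,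
        p.1 ∈ posBall k u r ∧ p.2 ∈ posBall k u r :=
      Filter.prod_mem_prod self_mem_nhdsWithin self_mem_nhdsWithin
    filter_upwards [hlim.eventually_lt_const hε, hmem] with p hp hpm
    rw [Real.dist_eq]
    exact (abs_sub_le_sum hl hβd hβle hpm.2 hpm.1).trans_lt hp
  exact CompleteSpace.complete hcau

/-- The point with `i`-th coordinate `p.2` whose other coordinates are those of `x`, increased by
`p.1`. -/
def inwardShift (x : Fin m → ℝ) (i : Fin m) (p : ℝ × ℝ) : Fin m → ℝ :=
  Function.update (fun j => x j + p.1) i p.2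

theorem continuous_inwardShift (x : Fin m → ℝ) (i : Fin m) : Continuous (inwardShift x i) := by
  refine Continuous.update (continuous_pi fun j => ?_) i continuous_snd
  exact continuous_const.add continuous_fst

theorem inwardShift_zero (x : Fin m → ℝ) (i : Fin m) (t : ℝ) :
    inwardShift x i (0, t) = Function.update x i t := by
  simp [inwardShift]

theorem inwardShift_mem {i : Fin m} {p : ℝ × ℝ} (hx : x ∈ corner m k)
    (hb : inwardShift x i p ∈ Metric.ball u r) (h1 : 0 < p.1) (h2 : (i : ℕ) < k → 0 < p.2) :
    inwardShift x i p ∈ posBall k u r := by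
  refine ⟨hb, fun j hj => ?_⟩
  by_cases hji : j = i
  · subst hji; simpa [inwardShift] using h2 hj
  · simp only [inwardShift, Function.update_of_ne hji]
    linarith [hx j hj]

/-- The shift moves a line in direction `i`, possibly contained in other faces, into the region
where the function is smooth, while the `i`-th coordinate stays free as the variable of
differentiation. -/
theorem tendsto_inwardShift (hx : x ∈ Metric.ball u r ∩ corner m k) {i : Fin m} {t : ℝ}
    (ht : Function.update x i t ∈ Metric.ball u r) (hpos : (i : ℕ) < k → 0 < t) :
    Filter.Tendsto (inwardShift x i) (𝓝[>] 0 ×ˢ 𝓝 t)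
      (𝓝[posBall k u r] (Function.update x i t)) := by
  have h1 : Filter.Tendsto (inwardShift x i) (𝓝[>] 0 ×ˢ 𝓝 t) (𝓝 (Function.update x i t)) := by
    have := (continuous_inwardShift x i).tendsto (0, t)
    rw [inwardShift_zero, nhds_prod_eq] at this
    exact this.mono_left (Filter.prod_mono_left _ nhdsWithin_le_nhds)
  refine tendsto_nhdsWithin_iff.2 ⟨h1, ?_⟩
  have h2 : ∀ᶠ p : ℝ × ℝ in 𝓝[>] 0 ×ˢ 𝓝 t, 0 < p.1 :=
    Filter.tendsto_fst.eventually self_mem_nhdsWithin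
  have h3 : ∀ᶠ p : ℝ × ℝ in 𝓝[>] 0 ×ˢ 𝓝 t, (i : ℕ) < k → 0 < p.2 := by
    by_cases h : (i : ℕ) < k
    · filter_upwards [Filter.tendsto_snd.eventually (lt_mem_nhds (hpos h))] with p hp _ using hp
    · exact Filter.Eventually.of_forall fun p h' => absurd h' h
  filter_upwards [h1 (Metric.isOpen_ball.mem_nhds ht), h2, h3] with p hp1 hp2 hp3
  exact inwardShift_mem hx.2 hp1 hp2 hp3

theorem corner_subset_closure : Metric.ball u r ∩ corner m k ⊆ closure (posBall k u r) := by
  intro x hx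
  have hc : Continuous fun s : ℝ => fun j : Fin m => x j + s :=
    continuous_pi fun j => continuous_const.add continuous_id
  have h1 : Filter.Tendsto (fun s : ℝ => fun j : Fin m => x j + s) (𝓝[>] 0) (𝓝 x) := by
    have := hc.tendsto 0
    simp only [add_zero] at this
    exact this.mono_left nhdsWithin_le_nhds
  refine mem_closure_of_tendsto h1 ?_
  filter_upwards [h1 (Metric.isOpen_ball.mem_nhds hx.1), self_mem_nhdsWithin] with s hs1 hs2
  refine ⟨hs1, fun j hj => ?_⟩
  have h3 : (0 : ℝ) < s := hs2
  linarith [hx.2 j hj]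

theorem BBounds.tendsto_extend (hf : BBounds k (posBall k u r) f)
    (l : List (Fin m)) (hx : x ∈ Metric.ball u r ∩ corner m k) :
    Filter.Tendsto (bDerivs k l f) (𝓝[posBall k u r] x)
      (𝓝 (extendFrom (posBall k u r) (bDerivs k l f) x)) :=
  tendsto_extendFrom (hf.exists_tendsto l (corner_subset_closure hx))

theorem BBounds.continuousOn_extend (hf : BBounds k (posBall k u r) f)
    (l : List (Fin m)) :
    ContinuousOn (extendFrom (posBall k u r) (bDerivs k l f)) (Metric.ball u r ∩ corner m k) :=
  continuousOn_extendFrom corner_subset_closure fun _ hx =>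
    hf.exists_tendsto l (corner_subset_closure hx)

/-- Differentiation of a limit: on the lines shifted inwards by `s` the function is smooth, and as
`s → 0+` its values converge and its derivatives converge uniformly near `x i`. The factor `c`
converts b-derivatives into ordinary ones. -/
theorem BBounds.hasDerivAt_extend (hf : BBounds k (posBall k u r) f)
    (l : List (Fin m)) (hx : x ∈ Metric.ball u r ∩ corner m k)
    {i : Fin m} (hi : (i : ℕ) < k → 0 < x i) :
    HasDerivAt (fun t : ℝ => extendFrom (posBall k u r) (bDerivs k l f) (Function.update x i t))
      ((if (i : ℕ) < k then x i else 1)⁻¹ *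
        extendFrom (posBall k u r) (bDerivs k (i :: l) f) x) (x i) := by
  set c : ℝ → ℝ := fun t => (if (i : ℕ) < k then t else 1)⁻¹ with hc
  have hcc : ContinuousAt c (x i) := by
    by_cases h : (i : ℕ) < k
    · simpa [hc, h] using continuousAt_inv₀ (hi h).ne'
    · simpa [hc, h] using continuousAt_const
  have hV := relOpen_ball k u r
  have hUx : Function.update x i (x i) = x := Function.update_eq_self i x
  have hshift : Filter.Tendsto (inwardShift x i) (𝓝[>] 0 ×ˢ 𝓝 (x i)) (𝓝[posBall k u r] x) := by
    have := tendsto_inwardShift (t := x i) hx (by rw [hUx]; exact hx.1) hi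
    rwa [hUx] at this
  have hupd : Filter.Tendsto (fun t : ℝ => Function.update x i t) (𝓝 (x i))
      (𝓝[Metric.ball u r ∩ corner m k] x) := by
    refine tendsto_nhdsWithin_iff.2 ⟨?_, hV.eventually_update_mem hx hi⟩
    have := (continuous_update_right x i).tendsto (x i)
    rwa [hUx] at this
  have hmain := hasDerivAt_of_tendstoUniformlyOnFilter (l := 𝓝[>] (0 : ℝ)) (x := x i)
    (f := fun s t => bDerivs k l f (inwardShift x i (s, t)))
    (f' := fun s t => c t * bDerivs k (i :: l) f (inwardShift x i (s, t)))
    (g := fun t => extendFrom (posBall k u r) (bDerivs k l f) (Function.update x i t))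
    (g' := fun t => c t *
      extendFrom (posBall k u r) (bDerivs k (i :: l) f) (Function.update x i t)) ?_ ?_ ?_
  · simpa [hc] using hmain
  -- Uniformity holds because the shifted derivative and its claimed limit both tend to the same
  -- value as `(s, t)` tends to `(0, x i)` jointly.
  · rw [tendstoUniformlyOnFilter_iff_tendsto]
    have h1 : Filter.Tendsto (fun q : ℝ × ℝ => c q.2 *
        extendFrom (posBall k u r) (bDerivs k (i :: l) f) (Function.update x i q.2))
        (𝓝[>] 0 ×ˢ 𝓝 (x i))
        (𝓝 (c (x i) * extendFrom (posBall k u r) (bDerivs k (i :: l) f) x)) :=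
      ((hcc.tendsto.mul ((hf.continuousOn_extend (i :: l) x hx).tendsto.comp hupd))).comp
        Filter.tendsto_snd
    have h2 : Filter.Tendsto (fun q : ℝ × ℝ => c q.2 *
        bDerivs k (i :: l) f (inwardShift x i (q.1, q.2))) (𝓝[>] 0 ×ˢ 𝓝 (x i))
        (𝓝 (c (x i) * extendFrom (posBall k u r) (bDerivs k (i :: l) f) x)) :=
      (hcc.tendsto.comp Filter.tendsto_snd).mul ((hf.tendsto_extend (i :: l) hx).comp hshift)
    exact (h1.prodMk_nhds h2).mono_right (nhds_le_uniformity _)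
  · filter_upwards [hshift self_mem_nhdsWithin] with p hp
    have h1 := hasDerivAt_line ((contDiffOn_bDerivs isOpen_posBall hf.smooth l
      (k := k)).differentiableAt_of_isOpen isOpen_posBall hp) i
    have h2 : bDerivs k (i :: l) f (inwardShift x i p) = _ :=
      bDeriv_eq_fderiv ((contDiffOn_bDerivs isOpen_posBall hf.smooth l
        (k := k)).differentiableAt_of_isOpen isOpen_posBall hp) i
    have h3 : inwardShift x i p i = p.2 := by simp [inwardShift]
    have h4 : ∀ t, Function.update (inwardShift x i p) i t = inwardShift x i (p.1, t) := by
      intro t; simp [inwardShift]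
    simp only [h4, h3] at h1 h2
    refine h1.congr_deriv ?_
    have hne : (if (i : ℕ) < k then p.2 else 1) ≠ 0 := by
      split_ifs with h
      · rw [← h3]; exact (hp.2 i h).ne'
      · exact one_ne_zero
    rw [show ((p.1, p.2) : ℝ × ℝ) = p from rfl, h2, smul_eq_mul, inv_mul_cancel_left₀ hne]
  · have hp : ∀ᶠ t in 𝓝 (x i), (i : ℕ) < k → 0 < t := by
      by_cases h : (i : ℕ) < k
      · filter_upwards [lt_mem_nhds (hi h)] with t ht _ using ht
      · exact Filter.Eventually.of_forall fun t h' => absurd h' h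
    filter_upwards [hV.eventually_update_mem hx hi, hp] with t ht htp
    have h1 := tendsto_inwardShift hx ht.1 htp
    have h2 : Filter.Tendsto (fun s : ℝ => (s, t)) (𝓝[>] (0 : ℝ)) (𝓝[>] 0 ×ˢ 𝓝 t) :=
      Filter.tendsto_id.prodMk tendsto_const_nhds
    exact (hf.tendsto_extend l ht).comp (h1.comp h2)

theorem BBounds.extend_eq_zero (hf : BBounds k (posBall k u r) f)
    {i : Fin m} (hi : (i : ℕ) < k) (l : List (Fin m))
    (hx : x ∈ Metric.ball u r ∩ corner m k) (h0 : x i = 0) :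
    extendFrom (posBall k u r) (bDerivs k (i :: l) f) x = 0 := by
  obtain ⟨δ, hδ, h⟩ := hf.decay i hi
  obtain ⟨C, hC⟩ := h l
  refine extendFrom_eq (corner_subset_closure hx) ?_
  refine squeeze_zero_norm' (a := fun y => C * y i ^ δ) ?_ ?_
  · filter_upwards [self_mem_nhdsWithin] with y hy using hC y hy
  · have hcont : Continuous fun y : Fin m → ℝ => C * y i ^ δ :=
      continuous_const.mul ((Real.continuous_rpow_const hδ.le).comp (continuous_apply i))
    have := hcont.tendsto x
    simp only [h0, Real.zero_rpow hδ.ne', mul_zero] at this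
    exact this.mono_left nhdsWithin_le_nhds

/-- Where `x_i = 0`, the left side vanishes because of the factor `x_i` in the b-derivative, and the
right side vanishes by decay. -/
theorem BBounds.bDerivs_extend (hf : BBounds k (posBall k u r) f)
    (l : List (Fin m)) :
    Set.EqOn (bDerivs k l (extendFrom (posBall k u r) f))
      (extendFrom (posBall k u r) (bDerivs k l f)) (Metric.ball u r ∩ corner m k) := by
  induction l with
  | nil => exact fun _ _ => rfl
  | cons i l ih =>
    intro x hx
    rw [bDerivs_cons, (relOpen_ball k u r).bDeriv_congr ih i hx]
    rcases (relOpen_ball k u r).pos_or_eq_zero hx i with hpos | ⟨hi, h0⟩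
    · rw [bDeriv_of_hasDerivAt (hf.hasDerivAt_extend l hx hpos), smul_eq_mul,
        mul_inv_cancel_left₀]
      split_ifs with h
      · exact (hpos h).ne'
      · exact one_ne_zero
    · rw [bDeriv_eq_zero hi h0, hf.extend_eq_zero hi l hx h0]

/-- Functions on the positive part of a ball with bounded b-derivatives that decay at the faces
extend to a-smooth functions up to the boundary. -/
theorem BBounds.aSmooth_extend (hf : BBounds k (posBall k u r) f) :
    ASmooth k (Metric.ball u r ∩ corner m k) (extendFrom (posBall k u r) f) where
  continuousOn l := (hf.continuousOn_extend l).congr (hf.bDerivs_extend l)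
  differentiable l i x hx hi := by
    refine (hf.hasDerivAt_extend l hx hi).differentiableAt.congr_of_eventuallyEq ?_
    filter_upwards [(relOpen_ball k u r).eventually_update_mem hx hi] with t ht
    exact hf.bDerivs_extend l ht
  decay l i hi S hS _ := by
    obtain ⟨δ, hδ, h⟩ := hf.decay i hi
    obtain ⟨C, hC⟩ := h l
    refine ⟨|C| + 1, by positivity, δ, hδ, fun x hx => ?_⟩
    have := mem_closure_iff_nhdsWithin_neBot.1 (corner_subset_closure (hS hx))
    have hcont : Continuous fun y : Fin m → ℝ => (|C| + 1) * y i ^ δ :=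
      continuous_const.mul ((Real.continuous_rpow_const hδ.le).comp (continuous_apply i))
    rw [hf.bDerivs_extend (i :: l) (hS hx)]
    -- The estimate on the positive part passes to the limit at boundary points.
    refine le_of_tendsto_of_tendsto (hf.tendsto_extend (i :: l) (hS hx)).abs
      ((hcont.tendsto x).mono_left nhdsWithin_le_nhds) ?_
    filter_upwards [self_mem_nhdsWithin] with y hy
    refine (hC y hy).trans (mul_le_mul_of_nonneg_right ?_ (Real.rpow_nonneg (hy.2 i hi).le _))
    linarith [le_abs_self C]

end Extension

/-- At faces that do not pass through `u`, the coordinate exceeds `u i - r > 0`, so boundedness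
already gives decay with exponent `1`. -/
theorem PhgExpansion.quotient_bBounds {m k : ℕ} {U : Set (Fin m → ℝ)} {h : (Fin m → ℝ) → ℝ}
    {u : Fin m → ℝ} {P : PhgExpansion k U h u} {r : ℝ} {lam : Fin m → ℝ}
    (hr : P.IsSmallRadius r) (hd : P.Dominates r lam) (hh : ContDiffOn ℝ ∞ h (posBall k u r)) :
    BBounds k (posBall k u r) fun x => h x * ∏ j ∈ zeroFaces k u, x j ^ (-lam j) := by
  obtain ⟨h1, h2, h3⟩ := quotient_bounds hr hd hh
  refine ⟨h1, h2, fun i hi => ?_⟩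
  by_cases hiZ : i ∈ zeroFaces k u
  · exact h3 i hiZ
  · have hlt := hr.lt_coord i hi hiZ
    refine ⟨1, one_pos, fun l => ?_⟩
    obtain ⟨C, hC⟩ := h2 (i :: l)
    refine ⟨C / (u i - r), fun x hx => (hC x hx).trans ?_⟩
    have h4 := (abs_lt.1 (abs_sub_lt_of_mem_ball hx.1 i)).1
    have h5 : 0 ≤ C := (abs_nonneg _).trans (hC x hx)
    rw [Real.rpow_one, div_mul_eq_mul_div, le_div_iff₀ (by linarith)]
    exact mul_le_mul_of_nonneg_left (by linarith) h5

/-! ### Expansions at nearby points -/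

namespace PhgExpansion

variable {m k : ℕ} {U U' : Set (Fin m → ℝ)} {h : (Fin m → ℝ) → ℝ} {u u' : Fin m → ℝ}

/-- The power is monotone or antitone according to the sign of `s`; the sum of the values at both
ends covers the two cases at once. -/
theorem rpow_le_add_rpow {a b t : ℝ} (ha : 0 < a) (hat : a ≤ t) (htb : t ≤ b) (s : ℝ) :
    t ^ s ≤ a ^ s + b ^ s := by
  have ht := ha.trans_le hat
  rcases le_total 0 s with hs | hs
  · linarith [Real.rpow_le_rpow ht.le htb hs, Real.rpow_nonneg ha.le s]
  · linarith [Real.rpow_le_rpow_of_nonpos ha hat hs, Real.rpow_nonneg (ht.le.trans htb) s]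

/-- An expansion near `u` gives an expansion near each nearby point `u'`, with respect to those
coordinates that still vanish at `u'`. -/
def restrict (P : PhgExpansion k U h u) {ε' : ℝ} (hε : 0 < ε')
    (hball : Metric.ball u' ε' ⊆ Metric.ball u P.ε) (hU : Metric.ball u' ε' ∩ corner m k ⊆ U')
    (hZ : zeroFaces k u' ⊆ zeroFaces k u)
    (hε' : ∀ j ∈ zeroFaces k u, j ∉ zeroFaces k u' → 0 < u' j ∧ ε' ≤ u' j / 2) :
    PhgExpansion k U' h u' where
  ε := ε'
  ε_pos := hε
  ball_subset := hU
  E := P.E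
  E_finite := P.E_finite
  G := P.G
  G_empty ι x hx hpos := P.G_empty ι x (hball hx) hpos
  G_index := P.G_index
  G_const := P.G_const
  G_smooth I hI ι hι := (P.G_smooth I (hI.trans hZ) ι hι).mono fun _ hx => ⟨hball hx.1, hx.2⟩
  M := P.M
  remainder I hI i hi hiI ι hι N l := by
    obtain ⟨C, hC⟩ := P.remainder I (hI.trans hZ) i (hZ hi) hiI ι hι N l
    set ins := insert i I
    -- A coordinate that vanishes at `u` but not at `u'` lies between `u'_j / 2` and `2 u'_j` on the
    -- smaller ball, so its factor in the remainder bound can be absorbed into the constant.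
    set B : ℝ := ∏ j ∈ (zeroFaces k u \ ins) \ (zeroFaces k u' \ ins),
      ((u' j / 2) ^ (-P.M) + (2 * u' j) ^ (-P.M))
    refine ⟨|C| * B, fun x hx hpos => (hC x (hball hx) hpos).trans ?_⟩
    rw [← Finset.prod_sdiff (Finset.sdiff_subset_sdiff hZ subset_rfl : zeroFaces k u' \ ins ⊆ _)]
    have hx0 : ∀ j ∈ zeroFaces k u, 0 < x j := fun j hj => hpos j (mem_zeroFaces.1 hj).1
    have hB : ∏ j ∈ (zeroFaces k u \ ins) \ (zeroFaces k u' \ ins), x j ^ (-P.M) ≤ B := by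
      refine Finset.prod_le_prod (fun j hj => ?_) fun j hj => ?_
      · exact Real.rpow_nonneg (hx0 j (Finset.sdiff_subset (Finset.sdiff_subset hj))).le _
      · obtain ⟨hj1, hj2⟩ := Finset.mem_sdiff.1 hj
        obtain ⟨hj3, hj4⟩ := Finset.mem_sdiff.1 hj1
        obtain ⟨hu0, hu⟩ := hε' j hj3 fun hj' => hj2 (Finset.mem_sdiff.2 ⟨hj', hj4⟩)
        have := abs_lt.1 (abs_sub_lt_of_mem_ball hx j)
        exact rpow_le_add_rpow (by linarith) (by linarith) (by linarith) _
    have h1 : 0 ≤ x i ^ N := Real.rpow_nonneg (hx0 i (hZ hi)).le _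
    have h2 : 0 ≤ ∏ j ∈ zeroFaces k u' \ ins, x j ^ (-P.M) := Finset.prod_nonneg fun j hj =>
      Real.rpow_nonneg (hx0 j (hZ (Finset.sdiff_subset hj))).le _
    have h3 : 0 ≤ ∏ j ∈ (zeroFaces k u \ ins) \ (zeroFaces k u' \ ins), x j ^ (-P.M) :=
      Finset.prod_nonneg fun j hj =>
        Real.rpow_nonneg (hx0 j (Finset.sdiff_subset (Finset.sdiff_subset hj))).le _
    calc C * x i ^ N * ((∏ j ∈ (zeroFaces k u \ ins) \ (zeroFaces k u' \ ins), x j ^ (-P.M)) *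
          ∏ j ∈ zeroFaces k u' \ ins, x j ^ (-P.M))
        ≤ |C| * x i ^ N * ((∏ j ∈ (zeroFaces k u \ ins) \ (zeroFaces k u' \ ins),
          x j ^ (-P.M)) * ∏ j ∈ zeroFaces k u' \ ins, x j ^ (-P.M)) :=
          mul_le_mul_of_nonneg_right (mul_le_mul_of_nonneg_right (le_abs_self C) h1)
            (mul_nonneg h3 h2)
      _ ≤ |C| * x i ^ N * (B * ∏ j ∈ zeroFaces k u' \ ins, x j ^ (-P.M)) := by gcongr
      _ = _ := by ring

/-- If the exponents that occur in the expansions at all points near `u` are bounded below by `lam`,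
then all coefficients near `u` with other exponents vanish, also those of the expansions at single
faces. -/
theorem dominates_of_occurs (P : PhgExpansion k U h u) {r : ℝ} (hr : r ≤ P.ε) {lam : Fin m → ℝ}
    (hU : Metric.ball u r ∩ corner m k ⊆ U')
    (hocc : ∀ v ∈ Metric.ball u r ∩ corner m k, ∀ i ∈ zeroFaces k v,
      ∀ P' : PhgExpansion k U' h v, ∀ p, P'.Occurs i p →
        ((lam i : ℂ) = p.1 ∧ p.2 = 0) ∨ lam i < p.1.re) :
    P.Dominates r lam := by
  classical
  intro I hI ι hι x hx hne i hi
  have hr0 : 0 < r := dist_nonneg.trans_lt hx.1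
  -- At this point exactly the coordinates in `I` vanish, so `G I ι` is a full coefficient of the
  -- expansion restricted to `v`.
  set v : Fin m → ℝ := fun j => if j ∈ I then 0 else x j with hv
  have hvball : v ∈ Metric.ball u r := by
    rw [Metric.mem_ball, dist_pi_lt_iff hr0]
    intro j
    rw [Real.dist_eq]
    by_cases hj : j ∈ I
    · simpa [hv, hj, (mem_zeroFaces.1 (hI hj)).2] using hr0
    · simpa [hv, hj] using abs_sub_lt_of_mem_ball hx.1 j
  have hvcorner : v ∈ corner m k := by
    intro j hj
    by_cases hjI : j ∈ I
    · simp [hv, hjI]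
    · simpa [hv, hjI] using (hx.2 j hj).le
  have hvZ : zeroFaces k v = I := by
    ext j
    rw [mem_zeroFaces]
    by_cases hj : j ∈ I
    · simp [hv, hj, (mem_zeroFaces.1 (hI hj)).1]
    · simp only [hv, hj, if_false, iff_false, not_and]
      exact fun hjk => (hx.2 j hjk).ne'
  obtain ⟨ε₁, hε₁, hsub⟩ := Metric.isOpen_iff.1 Metric.isOpen_ball v hvball
  have hev : ∀ᶠ ε' in 𝓝[>] (0 : ℝ), ε' < ε₁ ∧
      ∀ j : Fin m, j ∈ zeroFaces k u → j ∉ zeroFaces k v → ε' < v j / 2 := by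
    refine (eventually_nhdsWithin_of_eventually_nhds (gt_mem_nhds hε₁)).and ?_
    refine Filter.eventually_all.2 fun j => ?_
    by_cases hj : j ∈ zeroFaces k u ∧ j ∉ zeroFaces k v
    · have hj0 : 0 < v j / 2 := by
        have hjI : j ∉ I := hvZ ▸ hj.2
        have := hx.2 j (mem_zeroFaces.1 hj.1).1
        simp only [hv, hjI, if_false]
        linarith
      filter_upwards [eventually_nhdsWithin_of_eventually_nhds (gt_mem_nhds hj0)] with t ht _ _
        using ht
    · exact Filter.Eventually.of_forall fun t h1 h2 => absurd ⟨h1, h2⟩ hj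
  obtain ⟨ε', ⟨hε1, hε2⟩, hε0⟩ := (hev.and self_mem_nhdsWithin).exists
  have hε0 : 0 < ε' := hε0
  have hb : Metric.ball v ε' ⊆ Metric.ball u r := (Metric.ball_subset_ball hε1.le).trans hsub
  set P' : PhgExpansion k U' h v := P.restrict hε0 (hb.trans (Metric.ball_subset_ball hr))
    ((Set.inter_subset_inter_left _ hb).trans hU) (hvZ ▸ hI) fun j hj hj' =>
      ⟨by linarith [hε2 j hj hj'], (hε2 j hj hj').le⟩
  -- The point that witnesses nonvanishing has small positive coordinates in `I` and agrees with `x`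
  -- elsewhere, so `G I ι` takes the same value at both.
  refine hocc v ⟨hvball, hvcorner⟩ i (hvZ ▸ hi) P' (ι i) ⟨ι, hvZ ▸ hι, rfl,
    fun j => if j ∈ I then ε' / 2 else x j, ?_, fun j hj => ?_, ?_⟩
  · change _ ∈ Metric.ball v ε'
    rw [Metric.mem_ball, dist_pi_lt_iff hε0]
    intro j
    rw [Real.dist_eq]
    by_cases hj : j ∈ I
    · simp only [hv, hj, if_true, sub_zero, abs_of_pos (half_pos hε0)]
      linarith
    · simpa [hv, hj] using hε0
  · by_cases hjI : j ∈ I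
    · simpa [hjI] using hε0
    · simpa [hjI] using hx.2 j hj
  · rw [hvZ]
    change P.G I ι _ ≠ 0
    rwa [P.G_const I ι _ x fun j hj => if_neg hj]

theorem exists_isSmallRadius (P : PhgExpansion k U h u) (hu : u ∈ corner m k) :
    ∃ r, P.IsSmallRadius r := by
  have hev : ∀ᶠ r in 𝓝[>] (0 : ℝ), r < P.ε ∧ r < 1 ∧
      ∀ i : Fin m, (i : ℕ) < k → i ∉ zeroFaces k u → r < u i := by
    refine (eventually_nhdsWithin_of_eventually_nhds (gt_mem_nhds P.ε_pos)).and
      ((eventually_nhdsWithin_of_eventually_nhds (gt_mem_nhds one_pos)).and ?_)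
    refine Filter.eventually_all.2 fun i => ?_
    by_cases hi : (i : ℕ) < k ∧ i ∉ zeroFaces k u
    · have h0 : 0 < u i := (hu i hi.1).lt_of_ne fun h0 => hi.2 (mem_zeroFaces.2 ⟨hi.1, h0.symm⟩)
      filter_upwards [eventually_nhdsWithin_of_eventually_nhds (gt_mem_nhds h0)] with t ht _ _
        using ht
    · exact Filter.Eventually.of_forall fun t h1 h2 => absurd ⟨h1, h2⟩ hi
  obtain ⟨r, ⟨h1, h2, h3⟩, h0⟩ := (hev.and self_mem_nhdsWithin).exists
  exact ⟨r, h0, h1, h2.le, h3⟩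

end PhgExpansion

/-! ### Charts -/

theorem mem_corner_of_mem_source {X : Type*} [TopologicalSpace X] {m : ℕ} (c : Chart X m)
    {v : Fin m → ℝ} (hv : v ∈ c.source) : v ∈ corner m c.k := by
  obtain ⟨O, _, h⟩ := c.source_open
  exact (h ▸ hv : v ∈ O ∩ corner m c.k).2

theorem zeroFaces_eq_empty_iff {m k : ℕ} {v : Fin m → ℝ} (hv : v ∈ corner m k) :
    zeroFaces k v = ∅ ↔ ∀ i : Fin m, (i : ℕ) < k → 0 < v i := by
  rw [Finset.eq_empty_iff_forall_notMem]
  constructor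
  · intro h i hi
    exact (hv i hi).lt_of_ne fun h0 => h i (mem_zeroFaces.2 ⟨hi, h0.symm⟩)
  · intro h i hi
    obtain ⟨h1, h2⟩ := mem_zeroFaces.1 hi
    exact (h i h1).ne' h2

namespace Chart

variable {X : Type*} [TopologicalSpace X] {m : ℕ} (c c' : Chart X m)

theorem relOpen_source : RelOpen c.k c.source := c.source_open

theorem relOpen_inter_preimage {V : Set X} (hV : IsOpen V) :
    RelOpen c.k (c.source ∩ c.toFun ⁻¹' V) := by
  obtain ⟨O, hO, h⟩ := continuousOn_iff'.1 c.continuousOn_toFun V hV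
  rw [Set.inter_comm, h, Set.inter_comm]
  exact c.relOpen_source.inter hO

theorem relOpen_overlap : RelOpen c.k (c.overlap c') := c.relOpen_inter_preimage c'.target_open

/-- The points of the chart at which all boundary coordinates are positive. -/
def posSet : Set X := {y | y ∈ c.target ∧ ∀ i : Fin m, (i : ℕ) < c.k → 0 < c.invFun y i}

variable {c c'} {y : X}

theorem toFun_invFun (hy : y ∈ c.target) : c.toFun (c.invFun y) = y := c.right_inv' hy

theorem invFun_toFun {v : Fin m → ℝ} (hv : v ∈ c.source) : c.invFun (c.toFun v) = v :=
  c.left_inv' hv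

theorem invFun_mem (hy : y ∈ c.target) : c.invFun y ∈ c.source := c.map_target' hy

theorem invFun_mem_overlap (hy : y ∈ c.target) (hy' : y ∈ c'.target) :
    c.invFun y ∈ c.overlap c' :=
  ⟨invFun_mem hy, by rwa [Set.mem_preimage, toFun_invFun hy]⟩

theorem change_invFun (hy : y ∈ c.target) : c.change c' (c.invFun y) = c'.invFun y := by
  rw [change, toFun_invFun hy]

theorem continuousAt_invFun (hy : y ∈ c.target) : ContinuousAt c.invFun y :=
  c.continuousOn_invFun.continuousAt (c.target_open.mem_nhds hy)

theorem mem_closure_posSet (hy : y ∈ c.target) : y ∈ closure c.posSet := by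
  obtain ⟨O, hO, hsrc⟩ := c.source_open
  have hv : c.invFun y ∈ O ∩ corner m c.k := hsrc ▸ invFun_mem hy
  have hc : Continuous fun s : ℝ => fun j : Fin m => c.invFun y j + s :=
    continuous_pi fun j => continuous_const.add continuous_id
  have h1 : Filter.Tendsto (fun s : ℝ => fun j : Fin m => c.invFun y j + s) (𝓝[>] 0)
      (𝓝 (c.invFun y)) := by
    have := hc.tendsto 0
    simp only [add_zero] at this
    exact this.mono_left nhdsWithin_le_nhds
  have h2 : ∀ᶠ s : ℝ in 𝓝[>] 0, (fun j : Fin m => c.invFun y j + s) ∈ c.source ∧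
      ∀ j : Fin m, (j : ℕ) < c.k → 0 < c.invFun y j + s := by
    filter_upwards [h1 (hO.mem_nhds hv.1), self_mem_nhdsWithin] with s hs1 hs2
    have hs3 : (0 : ℝ) < s := hs2
    have hpos : ∀ j : Fin m, (j : ℕ) < c.k → 0 < c.invFun y j + s := fun j hj => by
      linarith [hv.2 j hj]
    exact ⟨hsrc ▸ ⟨hs1, fun j hj => (hpos j hj).le⟩, hpos⟩
  have h3 : Filter.Tendsto (fun s : ℝ => c.toFun fun j : Fin m => c.invFun y j + s) (𝓝[>] 0)
      (𝓝 y) := by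
    have := (c.continuousOn_toFun _ (invFun_mem hy)).tendsto.comp
      (tendsto_nhdsWithin_iff.2 ⟨h1, h2.mono fun _ h => h.1⟩)
    rwa [toFun_invFun hy] at this
  refine mem_closure_of_tendsto h3 (h2.mono fun s hs => ⟨c.map_source' hs.1, fun i hi => ?_⟩)
  rw [invFun_toFun hs.1]
  exact hs.2 i hi

/-- A boundary coordinate of `c'` does not vanish identically on a nonempty open set. -/
theorem exists_change_ne_zero {O : Set (Fin m → ℝ)} (hO : IsOpen O) (hy : y ∈ c.target)
    (hy' : y ∈ c'.target) (hyO : c.invFun y ∈ O) {j : Fin m} (hj : (j : ℕ) < c'.k) :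
    ¬ ∀ x ∈ c.overlap c' ∩ O, c.change c' x j = 0 := by
  intro h
  have hW : c.invFun ⁻¹' O ∩ c.target ∈ 𝓝 y :=
    Filter.inter_mem ((continuousAt_invFun hy) (hO.mem_nhds hyO)) (c.target_open.mem_nhds hy)
  obtain ⟨z, ⟨hzO, hz⟩, hz', hpos⟩ := mem_closure_iff_nhds.1 (mem_closure_posSet hy') _ hW
  have h0 := h (c.invFun z) ⟨invFun_mem_overlap hz hz', hzO⟩
  rw [change_invFun hz] at h0
  exact (hpos j hj).ne' h0

/-- The monomial form of an a-smooth change of coordinates. -/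
theorem exists_aMonomial (h : ASmoothMap c.k c'.k (c.overlap c') (c.change c'))
    (hy : y ∈ c.target) (hy' : y ∈ c'.target) :
    ∃ O : Set (Fin m → ℝ), IsOpen O ∧ c.invFun y ∈ O ∧ ∃ a : Fin m → Fin m → ℝ,
      ∀ j : Fin m, (j : ℕ) < c'.k → AMonomial c.k (c.overlap c' ∩ O) (c.invFun y)
        (fun x => c.change c' x j) fun i => a i j := by
  obtain ⟨O, hO, hyO, hj⟩ := h.2.2 _ (invFun_mem_overlap hy hy')
  have key : ∀ j : Fin m, ∃ a : Fin m → ℝ, (j : ℕ) < c'.k →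
      AMonomial c.k (c.overlap c' ∩ O) (c.invFun y) (fun x => c.change c' x j) a := by
    intro j
    by_cases hjk : (j : ℕ) < c'.k
    · rcases hj j hjk with ⟨a, ha⟩ | h0
      · exact ⟨a, fun _ => ha⟩
      · exact absurd h0 (exists_change_ne_zero hO hy hy' hyO hjk)
    · exact ⟨0, fun h => absurd h hjk⟩
  choose a ha using key
  exact ⟨O, hO, hyO, fun i j => a j i, ha⟩

/-- A boundary coordinate of `c'` is a positive function times powers of boundary coordinates of
`c`. Coordinates of arbitrary sign enter with exponent `0` only. -/
theorem mem_posSet_of_mem_posSet (h : ASmoothMap c.k c'.k (c.overlap c') (c.change c'))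
    (hy : y ∈ c.posSet) (hy' : y ∈ c'.target) : y ∈ c'.posSet := by
  refine ⟨hy', fun j hj => ?_⟩
  obtain ⟨O, _, hyO, a, ha⟩ := exists_aMonomial h hy.1 hy'
  obtain ⟨_, h2, F, _, hFpos, hF⟩ := ha j hj
  have hmem : c.invFun y ∈ c.overlap c' ∩ O := ⟨invFun_mem_overlap hy.1 hy', hyO⟩
  have h1 := hF _ hmem
  simp only [change_invFun hy.1] at h1
  rw [h1]
  refine mul_pos (hFpos _ hmem) (Finset.prod_pos fun i _ => ?_)
  by_cases hi : (i : ℕ) < c.k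
  · exact Real.rpow_pos_of_pos (hy.2 i hi) _
  · have h3 : a i j = 0 := h2 i fun hi' => hi (mem_zeroFaces.1 hi').1
    rw [h3, Real.rpow_zero]
    exact one_pos

/-- Restriction of a chart to an open subset of its domain. -/
def restrictOpen (c : Chart X m) {O : Set (Fin m → ℝ)} (hO : IsOpen O) : Chart X m where
  toFun := c.toFun
  invFun := c.invFun
  source := c.source ∩ O
  target := c.target ∩ c.invFun ⁻¹' O
  map_source' v hv := ⟨c.map_source' hv.1, by
    rw [Set.mem_preimage, invFun_toFun hv.1]; exact hv.2⟩
  map_target' y hy := ⟨c.map_target' hy.1, hy.2⟩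
  left_inv' v hv := c.left_inv' hv.1
  right_inv' y hy := c.right_inv' hy.1
  k := c.k
  k_le := c.k_le
  source_open := c.relOpen_source.inter hO
  target_open := c.continuousOn_invFun.isOpen_inter_preimage c.target_open hO
  continuousOn_toFun := c.continuousOn_toFun.mono Set.inter_subset_left
  continuousOn_invFun := c.continuousOn_invFun.mono Set.inter_subset_left

end Chart

/-! ### Charts of `X` as a-charts, and the interior -/

theorem SmoothMap.mono {m n k l : ℕ} {U U' : Set (Fin m → ℝ)} {f : (Fin m → ℝ) → (Fin n → ℝ)}
    (hf : SmoothMap k l U f) (h : U' ⊆ U) : SmoothMap k l U' f := by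
  refine ⟨hf.1.mono h, fun u hu => ?_⟩
  obtain ⟨O, hO, huO, hj⟩ := hf.2 u (h hu)
  have hsub : U' ∩ O ⊆ U ∩ O := Set.inter_subset_inter_left _ h
  refine ⟨O, hO, huO, fun j hjl => (hj j hjl).imp ?_ fun h0 x hx => h0 x (hsub hx)⟩
  rintro ⟨a, ha, F, hF, hpos, hfF⟩
  exact ⟨a, ha, F, hF.mono hsub, fun x hx => hpos x (hsub hx), fun x hx => hfF x (hsub hx)⟩

/-- Smooth maps of manifolds with corners are a-smooth. -/
theorem SmoothMap.aSmoothMap {m n k l : ℕ} {U : Set (Fin m → ℝ)}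
    {f : (Fin m → ℝ) → (Fin n → ℝ)} (hU : RelOpen k U) (hf : SmoothMap k l U f) :
    ASmoothMap k l U f := by
  refine ⟨hf.1.continuousOn, fun j _ => hU.aSmooth (contDiffOn_pi.1 hf.1 j), fun u hu => ?_⟩
  obtain ⟨O, hO, huO, hj⟩ := hf.2 u hu
  refine ⟨O, hO, huO, fun j hjl => (hj j hjl).imp_left ?_⟩
  rintro ⟨a, ha, F, hF, hpos, hfF⟩
  refine ⟨fun i => a i, fun i => Nat.cast_nonneg _, fun i hi => by simp [ha i hi], F,
    (hU.inter hO).aSmooth hF, hpos, fun x hx => ?_⟩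
  simpa only [Real.rpow_natCast] using hfF x hx

namespace CornersStructure

variable {X : Type*} [TopologicalSpace X] {m : ℕ} (M : CornersStructure X m)

theorem atlas_subset_aAtlas : M.atlas ⊆ M.aAtlas := fun c hc c' hc' =>
  ⟨(M.compatible c hc c' hc').1.aSmoothMap (c.relOpen_overlap c'),
    (M.compatible c hc c' hc').2.aSmoothMap (c'.relOpen_overlap c)⟩

variable {M}

/-- By maximality of the atlas, since compatibility is inherited by smaller domains. It allows
charts to be shrunk until their faces are connected. -/
theorem restrictOpen_mem_atlas {c : Chart X m} (hc : c ∈ M.atlas) {O : Set (Fin m → ℝ)}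
    (hO : IsOpen O) : c.restrictOpen hO ∈ M.atlas := by
  refine M.maximal _ fun c' hc' => ?_
  obtain ⟨h1, h2⟩ := M.compatible c hc c' hc'
  exact ⟨h1.mono fun x hx => ⟨hx.1.1, hx.2⟩, h2.mono fun x hx => ⟨hx.1, hx.2.1⟩⟩

/-- The interior can be tested in any a-chart: a-compatibility with a chart of `X`, in both
directions, transports positivity of the boundary coordinates. -/
theorem mem_posSet_iff {c : Chart X m} (hc : c ∈ M.aAtlas) {y : X} (hy : y ∈ c.target) :
    y ∈ c.posSet ↔ y ∈ M.interior := by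
  have hiff : ∀ d : Chart X m, y ∈ d.target →
      (zeroFaces d.k (d.invFun y) = ∅ ↔ y ∈ d.posSet) := fun d hd =>
    (zeroFaces_eq_empty_iff (mem_corner_of_mem_source d (Chart.invFun_mem hd))).trans
      ⟨fun h => ⟨hd, h⟩, fun h => h.2⟩
  constructor
  · intro hpos
    obtain ⟨d, hd, hyd⟩ := M.cover y
    exact ⟨d, hd, hyd, (hiff d hyd).2 (Chart.mem_posSet_of_mem_posSet (hc d hd).1 hpos hyd)⟩
  · rintro ⟨d, hd, hyd, h0⟩
    exact Chart.mem_posSet_of_mem_posSet (hc d hd).2 ((hiff d hyd).1 h0) hy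

theorem interiorOf_aAtlas : interiorOf M.aAtlas = M.interior := by
  ext y
  constructor
  · rintro ⟨c, hc, hy, h0⟩
    refine (mem_posSet_iff hc hy).1 ⟨hy, ?_⟩
    exact (zeroFaces_eq_empty_iff (mem_corner_of_mem_source c (Chart.invFun_mem hy))).1 h0
  · rintro ⟨c, hc, hy, h0⟩
    exact ⟨c, M.atlas_subset_aAtlas hc, hy, h0⟩

variable (M) in
theorem neBot_nhdsWithin_interior (y : X) : (𝓝[M.interior] y).NeBot := by
  obtain ⟨c, hc, hy⟩ := M.cover y
  refine mem_closure_iff_nhdsWithin_neBot.1 (closure_mono ?_ (Chart.mem_closure_posSet hy))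
  exact fun z hz => (mem_posSet_iff (M.atlas_subset_aAtlas hc) hz.1).1 hz

theorem eventually_posSet {c : Chart X m} (hc : c ∈ M.aAtlas) {y : X} (hy : y ∈ c.target) :
    ∀ᶠ z in 𝓝[M.interior] y, z ∈ c.posSet := by
  filter_upwards [self_mem_nhdsWithin, mem_nhdsWithin_of_mem_nhds (c.target_open.mem_nhds hy)]
    with z hz1 hz2
  exact (mem_posSet_iff hc hz2).2 hz1

end CornersStructure

/-! ### Quotients of the monomials of two charts -/

namespace Weight

open CornersStructure

variable {X : Type*} [TopologicalSpace X] {m : ℕ} {M : CornersStructure X m}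
  (w : Weight M.aAtlas) {c c' d : Chart X m} {y : X}

theorem mono_pos (hy : y ∈ c.posSet) : 0 < w.mono c y := by
  refine Finset.prod_pos fun i _ => ?_
  split_ifs with hi
  · exact Real.rpow_pos_of_pos (hy.2 i hi) _
  · exact one_pos

/-- The quotient of the monomials of an a-chart and a chart of `X` has a positive limit at each
boundary point. -/
theorem exists_tendsto_mono_div (hc : c ∈ M.aAtlas) (hcg : c.Good) (hd : d ∈ M.atlas)
    (hdg : d.Good) (hy : y ∈ c.target) (hyd : y ∈ d.target) :
    ∃ L > 0, Filter.Tendsto (fun z => w.mono d z / w.mono c z) (𝓝[M.interior] y) (𝓝 L) := by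
  obtain ⟨O, hO, hyO, a, ha⟩ := Chart.exists_aMonomial (hc d hd).1 hy hyd
  have hdA := M.atlas_subset_aAtlas hd
  have hval := w.val_change c hc hcg d hdA hdg _ (Chart.invFun_mem_overlap hy hyd) O hO hyO a ha
  have key : ∀ j : Fin m, ∃ F : (Fin m → ℝ) → ℝ, (j : ℕ) < d.k →
      ContinuousOn F (c.overlap d ∩ O) ∧ (∀ x ∈ c.overlap d ∩ O, 0 < F x) ∧
      ∀ x ∈ c.overlap d ∩ O, c.change d x j = F x * ∏ i, x i ^ a i j := by
    intro j
    by_cases hj : (j : ℕ) < d.k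
    · obtain ⟨_, _, F, hF, h1, h2⟩ := ha j hj
      exact ⟨F, fun _ => ⟨hF.continuousOn [], h1, h2⟩⟩
    · exact ⟨0, fun h => absurd h hj⟩
  choose F hF using key
  set v := c.invFun y with hv
  set Z := zeroFaces c.k v with hZ
  have hvmem : v ∈ c.overlap d ∩ O := ⟨Chart.invFun_mem_overlap hy hyd, hyO⟩
  have hvpos : ∀ i : Fin m, (i : ℕ) < c.k → i ∉ Z → 0 < v i := fun i hi hiZ =>
    (mem_corner_of_mem_source c (Chart.invFun_mem hy) i hi).lt_of_ne
      fun h0 => hiZ (mem_zeroFaces.2 ⟨hi, h0.symm⟩)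
  -- `A` collects the positive factors `F_j` of the change of coordinates, and `B` the boundary
  -- coordinates of `c` that do not vanish at `y`. Both are continuous and positive there, and the
  -- limit is `A v / B v` once the powers of the vanishing coordinates cancel.
  set A : (Fin m → ℝ) → ℝ := fun x => ∏ j : Fin m, if (j : ℕ) < d.k then F j x ^ w.val d j else 1
  set B : (Fin m → ℝ) → ℝ := fun x =>
    ∏ i : Fin m, if (i : ℕ) < c.k ∧ i ∉ Z then x i ^ w.val c i else 1
  have hApos : 0 < A v := Finset.prod_pos fun j _ => by
    split_ifs with hj
    · exact Real.rpow_pos_of_pos ((hF j hj).2.1 v hvmem) _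
    · exact one_pos
  have hBpos : 0 < B v := Finset.prod_pos fun i _ => by
    split_ifs with hi
    · exact Real.rpow_pos_of_pos (hvpos i hi.1 hi.2) _
    · exact one_pos
  have hinv : Filter.Tendsto c.invFun (𝓝[M.interior] y) (𝓝[c.overlap d ∩ O] v) := by
    refine tendsto_nhdsWithin_iff.2
      ⟨(Chart.continuousAt_invFun hy).tendsto.mono_left nhdsWithin_le_nhds, ?_⟩
    have h1 : ∀ᶠ z in 𝓝 y, c.invFun z ∈ c.overlap d ∩ O := by
      filter_upwards [c.target_open.mem_nhds hy, d.target_open.mem_nhds hyd,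
        (Chart.continuousAt_invFun hy) (hO.mem_nhds hyO)] with z h1 h2 h3
      exact ⟨Chart.invFun_mem_overlap h1 h2, h3⟩
    exact mem_nhdsWithin_of_mem_nhds h1
  have hAt : Filter.Tendsto A (𝓝[c.overlap d ∩ O] v) (𝓝 (A v)) := by
    refine tendsto_finsetProd _ fun j _ => ?_
    split_ifs with hj
    · exact ((hF j hj).1 v hvmem).rpow_const (Or.inl ((hF j hj).2.1 v hvmem).ne')
    · exact tendsto_const_nhds
  have hBt : Filter.Tendsto B (𝓝[c.overlap d ∩ O] v) (𝓝 (B v)) := by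
    refine tendsto_finsetProd _ fun i _ => ?_
    split_ifs with hi
    · exact ((continuous_apply i).continuousAt.continuousWithinAt).rpow_const
        (Or.inl (hvpos i hi.1 hi.2).ne')
    · exact tendsto_const_nhds
  refine ⟨A v / B v, div_pos hApos hBpos, ?_⟩
  refine ((hAt.div hBt hBpos.ne').comp hinv).congr' ?_
  filter_upwards [eventually_posSet hc hy, eventually_posSet hdA hyd,
    hinv.eventually self_mem_nhdsWithin] with z hz hzd hzO
  have hzpos : ∀ i ∈ Z, 0 < c.invFun z i := fun i hi => hz.2 i (mem_zeroFaces.1 hi).1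
  set x := c.invFun z
  have hmc : w.mono c z = (∏ i ∈ Z, x i ^ w.val c i) * B x := by
    simp only [Weight.mono, B]
    rw [← Finset.prod_filter_mul_prod_filter_not Finset.univ (· ∈ Z), Finset.filter_univ_mem]
    congr 1
    · exact Finset.prod_congr rfl fun i hi => if_pos (mem_zeroFaces.1 hi).1
    · rw [← Finset.prod_filter_mul_prod_filter_not Finset.univ (· ∈ Z) (fun i =>
        if (i : ℕ) < c.k ∧ i ∉ Z then x i ^ w.val c i else 1), Finset.filter_univ_mem,
        Finset.prod_eq_one (s := Z) fun i hi => if_neg fun h => h.2 hi, one_mul]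
      refine Finset.prod_congr rfl fun i hi => ?_
      simp [(Finset.mem_filter.1 hi).2, x]
  have hmd : w.mono d z = A x * ∏ i ∈ Z, x i ^ w.val c i := by
    have h1 : ∀ j : Fin m, (if (j : ℕ) < d.k then d.invFun z j ^ w.val d j else 1) =
        (if (j : ℕ) < d.k then F j x ^ w.val d j else 1) *
          ∏ i ∈ Z, x i ^ (if (j : ℕ) < d.k then a i j * w.val d j else 0) := by
      intro j
      split_ifs with hj
      · have h2 := (hF j hj).2.2 x hzO
        rw [Chart.change_invFun hz.1] at h2
        have h3 : ∏ i, x i ^ a i j = ∏ i ∈ Z, x i ^ a i j := by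
          refine (Finset.prod_subset (Finset.subset_univ Z) fun i _ hi => ?_).symm
          have h5 : a i j = 0 := (ha j hj).2.1 i hi
          rw [h5, Real.rpow_zero]
        have h4 : ∀ i ∈ Z, 0 ≤ x i ^ a i j := fun i hi => Real.rpow_nonneg (hzpos i hi).le _
        rw [h2, h3, Real.mul_rpow ((hF j hj).2.1 x hzO).le (Finset.prod_nonneg h4),
          ← Real.finsetProd_rpow _ _ h4]
        congr 1
        exact Finset.prod_congr rfl fun i hi => (Real.rpow_mul (hzpos i hi).le _ _).symm
      · simp
    simp only [Weight.mono, A]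
    rw [Finset.prod_congr rfl fun j _ => h1 j, Finset.prod_mul_distrib, Finset.prod_comm]
    congr 1
    refine Finset.prod_congr rfl fun i hi => ?_
    -- The transformation rule for weights: the total exponent of `x_i` in the monomial of `d` is
    -- its exponent in the monomial of `c`.
    rw [← Real.rpow_sum_of_pos (hzpos i hi), ← hval i hi]
  have hne : (∏ i ∈ Z, x i ^ w.val c i) ≠ 0 :=
    (Finset.prod_pos fun i hi => Real.rpow_pos_of_pos (hzpos i hi) _).ne'
  simp only [Function.comp_apply, Pi.div_apply]
  rw [hmc, hmd, mul_comm (A x), mul_div_mul_left _ _ hne]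

end Weight

/-! ### Sections of `L_λ` -/

namespace Weight

open CornersStructure

variable {X : Type*} [TopologicalSpace X] {m : ℕ} {M : CornersStructure X m}
  (w : Weight M.aAtlas)

/-- Near each point, `g` divided by the leading monomial of a suitable chart extends to an a-smooth
function. -/
theorem exists_local_extension {g : X → ℝ} (hg : M.IsPolyhomogeneous g)
    (hw : ∀ p : M.BoundaryPoint, p.chart.Good → ∀ r ∈ M.indexSet g p,
      (((w.val p.chart p.face : ℝ) : ℂ) = r.1 ∧ r.2 = 0) ∨ w.val p.chart p.face < r.1.re) (x : X) :
    ∃ d ∈ M.atlas, d.Good ∧ x ∈ d.target ∧ ∃ f : (Fin m → ℝ) → ℝ, ASmooth d.k d.source f ∧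
      ∀ y ∈ d.target,
        Filter.Tendsto (fun z => g z / w.mono d z) (𝓝[M.interior] y) (𝓝 (f (d.invFun y))) := by
  obtain ⟨c, hc, hx⟩ := M.cover x
  set u := c.invFun x
  have hu : u ∈ c.source := Chart.invFun_mem hx
  obtain ⟨P⟩ := hg.2 c hc u hu
  obtain ⟨r, hr⟩ := P.exists_isSmallRadius (mem_corner_of_mem_source c hu)
  -- On a small ball the faces are convex, hence connected, so that the weight has a single
  -- coefficient on each of them.
  set d : Chart X m := c.restrictOpen (Metric.isOpen_ball (x := u) (ε := r)) with hd_def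
  have hsource : d.source = Metric.ball u r ∩ corner m c.k := by
    ext v
    constructor
    · rintro ⟨h1, h2⟩
      exact ⟨h2, mem_corner_of_mem_source c h1⟩
    · rintro ⟨h1, h2⟩
      exact ⟨P.ball_subset ⟨Metric.ball_subset_ball hr.lt.le h1, h2⟩, h1⟩
  have hd : d ∈ M.atlas := restrictOpen_mem_atlas hc _
  have hdg : d.Good := by
    intro i _
    have h1 : {v | v ∈ d.source ∧ v i = 0} =
        (Metric.ball u r ∩ corner m c.k) ∩ {v : Fin m → ℝ | v i = 0} := by
      rw [hsource]; rfl
    rw [h1]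
    refine (((convex_ball u r).inter (convex_corner m c.k)).inter ?_).isPreconnected
    intro v hv v' hv' a b _ _ _
    have h2 : v i = 0 := hv
    have h3 : v' i = 0 := hv'
    change a * v i + b * v' i = 0
    rw [h2, h3]
    ring
  -- Every point of a face of `d` is itself a boundary point presented by `d`, with the same
  -- coefficient of the weight. So the hypothesis on index sets applies at all points near `u` with
  -- one exponent `w.val d i`.
  have hdom : P.Dominates r (w.val d) := by
    refine P.dominates_of_occurs (U' := d.source) hr.lt.le hsource.ge fun v hv i hi P' p hp => ?_
    have hv' : v ∈ d.source := hsource.ge hv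
    exact hw ⟨d, hd, v, hv', i, hi⟩ hdg p ⟨⟨d, hd, v, hv', i, hi⟩, .refl _, P', hp⟩
  have hh : ContDiffOn ℝ ∞ (g ∘ c.toFun) (posBall c.k u r) := by
    refine (hg.1 c hc).mono fun v hv => ⟨(hsource.ge ⟨hv.1, fun i hi => (hv.2 i hi).le⟩).1, hv.2⟩
  have hB := PhgExpansion.quotient_bBounds hr hdom hh
  refine ⟨d, hd, hdg, ⟨hx, Metric.mem_ball_self hr.pos⟩, _, hsource ▸ hB.aSmooth_extend,
    fun y hy => ?_⟩
  have hyV : d.invFun y ∈ Metric.ball u r ∩ corner m c.k := hsource ▸ Chart.invFun_mem hy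
  have hdA := M.atlas_subset_aAtlas hd
  have hpos := eventually_posSet hdA hy
  have hinv : Filter.Tendsto d.invFun (𝓝[M.interior] y) (𝓝[posBall c.k u r] (d.invFun y)) := by
    refine tendsto_nhdsWithin_iff.2
      ⟨(Chart.continuousAt_invFun hy).tendsto.mono_left nhdsWithin_le_nhds, ?_⟩
    filter_upwards [hpos] with z hz
    exact ⟨hz.1.2, hz.2⟩
  refine ((hB.tendsto_extend [] hyV).comp hinv).congr' ?_
  filter_upwards [hpos] with z hz
  have hz1 : c.toFun (d.invFun z) = z := Chart.toFun_invFun hz.1.1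
  -- Faces not through `u` miss the ball and have weight `0`, so the monomial of `d` involves only
  -- the coordinates that vanish at `u`.
  have hval : ∀ i : Fin m, (i : ℕ) < c.k → i ∉ zeroFaces c.k u → w.val d i = 0 := by
    intro i hi hiZ
    refine w.val_empty d hdA hdg i hi fun v hv => ?_
    have h1 := abs_lt.1 (abs_sub_lt_of_mem_ball (hsource ▸ hv : v ∈ _ ∩ corner m c.k).1 i)
    have h2 := hr.lt_coord i hi hiZ
    exact (by linarith : 0 < v i).ne'
  have hmono : w.mono d z = ∏ j ∈ zeroFaces c.k u, d.invFun z j ^ w.val d j := by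
    rw [Weight.mono, ← Finset.prod_subset (Finset.subset_univ (zeroFaces c.k u))]
    · exact Finset.prod_congr rfl fun j hj => if_pos (mem_zeroFaces.1 hj).1
    · intro j _ hj
      split_ifs with hjk
      · rw [hval j hjk hj, Real.rpow_zero]
      · rfl
  change (g ∘ c.toFun) (d.invFun z) * ∏ j ∈ zeroFaces c.k u, d.invFun z j ^ (-w.val d j) = _
  rw [Function.comp_apply, hz1, hmono, div_eq_mul_inv, ← Finset.prod_inv_distrib]
  congr 1
  exact Finset.prod_congr rfl fun j hj =>
    Real.rpow_neg (hz.2 j (mem_zeroFaces.1 hj).1).le _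

/-- Each point has a chart of `X` with connected faces. -/
def HasGoodChart (M : CornersStructure X m) (x : X) : Prop :=
  ∃ d ∈ M.atlas, d.Good ∧ x ∈ d.target

variable {w} {x : X}

/-- Membership in the a-atlas asserts compatibility with charts of `X` only, so two a-charts are
compared through a chart `d` of `X`. The positive limit of the second quotient permits the division.
-/
theorem trans_tendsto (hx : HasGoodChart M x) (c c' : w.Frame x) :
    Filter.Tendsto (fun z => w.mono c'.1 z / w.mono c.1 z) (𝓝[M.interior] x)
      (𝓝 (w.trans c.1 c'.1 x)) := by
  obtain ⟨d, hd, hdg, hxd⟩ := hx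
  obtain ⟨L, _, hL⟩ := w.exists_tendsto_mono_div c.2.1 c.2.2.1 hd hdg c.2.2.2 hxd
  obtain ⟨L', hL'0, hL'⟩ := w.exists_tendsto_mono_div c'.2.1 c'.2.2.1 hd hdg c'.2.2.2 hxd
  have h : Filter.Tendsto (fun z => w.mono c'.1 z / w.mono c.1 z) (𝓝[M.interior] x)
      (𝓝 (L / L')) := by
    refine (hL.div hL' hL'0.ne').congr' ?_
    filter_upwards [eventually_posSet (M.atlas_subset_aAtlas hd) hxd] with z hz
    have := (w.mono_pos hz).ne'
    simp only [Pi.div_apply]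
    rw [div_div_div_cancel_left' _ _ this]
  rw [trans, interiorOf_aAtlas]
  exact tendsto_nhds_limUnder ⟨_, h⟩

/-- The coefficient, with respect to the basis section of `c`, of the extension of `g`. -/
def extensionCoeff (w : Weight M.aAtlas) (g : X → ℝ) (x : X) (c : w.Frame x) : ℝ :=
  Filter.limUnder (𝓝[M.interior] x) fun z => g z / w.mono c.1 z

/-- From `g / mono c = (mono d / mono c) · (g / mono d)`: convergence in one frame gives convergence
in all, and the limits obey the transition law of `L_λ`. -/
theorem tendsto_of_tendsto {g : X → ℝ} (hx : HasGoodChart M x) {d : w.Frame x} {L : ℝ}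
    (hL : Filter.Tendsto (fun z => g z / w.mono d.1 z) (𝓝[M.interior] x) (𝓝 L)) (c : w.Frame x) :
    Filter.Tendsto (fun z => g z / w.mono c.1 z) (𝓝[M.interior] x)
      (𝓝 (w.trans c.1 d.1 x * L)) := by
  refine ((trans_tendsto hx c d).mul hL).congr' ?_
  filter_upwards [eventually_posSet d.2.1 d.2.2.2] with z hz
  rw [mul_comm, div_mul_div_cancel₀ (w.mono_pos hz).ne']

end Weight

end ACorners

end

/-! ### Existence and uniqueness of the section -/

open ACorners in
theorem lemma5p2 {X : Type*} [TopologicalSpace X] [T2Space X] [SecondCountableTopology X] {m : ℕ}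
    (M : CornersStructure X m) (g : X → ℝ) (hg : M.IsPolyhomogeneous g) (w : Weight M.aAtlas)
    (hw : ∀ p : M.BoundaryPoint, p.chart.Good → ∀ r ∈ M.indexSet g p,
      (((w.val p.chart p.face : ℝ) : ℂ) = r.1 ∧ r.2 = 0) ∨ w.val p.chart p.face < r.1.re) :
    ∃! s : (∀ x, w.fibre x), w.IsASmoothSection s ∧ w.RestrictsTo s g M.interior := by
  have hloc := w.exists_local_extension hg hw
  have hgood : ∀ x, Weight.HasGoodChart M x := fun x => by
    obtain ⟨d, hd, hdg, hx, _⟩ := hloc x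
    exact ⟨d, hd, hdg, hx⟩
  have hlim : ∀ x (c : w.Frame x), Filter.Tendsto (fun z => g z / w.mono c.1 z)
      (𝓝[M.interior] x) (𝓝 (w.extensionCoeff g x c)) := by
    intro x c
    obtain ⟨d, hd, hdg, hx, f, _, hf⟩ := hloc x
    exact tendsto_nhds_limUnder ⟨_, Weight.tendsto_of_tendsto (hgood x)
      (d := ⟨d, M.atlas_subset_aAtlas hd, hdg, hx⟩) (hf x hx) c⟩
  have huniq : ∀ x (c : w.Frame x) (L : ℝ), Filter.Tendsto (fun z => g z / w.mono c.1 z)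
      (𝓝[M.interior] x) (𝓝 L) → w.extensionCoeff g x c = L := fun x c L hL =>
    have := M.neBot_nhdsWithin_interior x
    tendsto_nhds_unique (hlim x c) hL
  have hfib : ∀ x, w.extensionCoeff g x ∈ w.fibre x := fun x c c' =>
    huniq x c _ (Weight.tendsto_of_tendsto (hgood x) (hlim x c') c)
  refine ⟨fun x => ⟨w.extensionCoeff g x, hfib x⟩, ⟨fun x => ?_, fun x hx c => ?_⟩, ?_⟩
  · obtain ⟨d, hd, hdg, hx, f, hf, hlimf⟩ := hloc x
    refine ⟨⟨d, M.atlas_subset_aAtlas hd, hdg, hx⟩, f, hf, fun v hv => ?_⟩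
    have h1 := hlimf (d.toFun v) (d.map_source' hv)
    rw [Chart.invFun_toFun hv] at h1
    exact (huniq _ ⟨d, M.atlas_subset_aAtlas hd, hdg, d.map_source' hv⟩ _ h1).symm
  · have hpos : x ∈ c.1.posSet := (CornersStructure.mem_posSet_iff c.2.1 c.2.2.2).2 hx
    -- An interior point lies in the set along which the limit is taken, so the limit is the value
    -- at the point.
    have h1 : w.extensionCoeff g x c = g x / w.mono c.1 x :=
      (tendsto_nhds_unique ((hlim x c).mono_left (pure_le_nhdsWithin hx))
        (tendsto_pure_nhds _ x))
    change w.extensionCoeff g x c * w.mono c.1 x = g x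
    rw [h1, div_mul_cancel₀ _ (w.mono_pos hpos).ne']
  · rintro s ⟨hsmooth, hres⟩
    funext x
    obtain ⟨d, f, hf, hfs⟩ := hsmooth x
    have hx := d.2.2.2
    have hinv : Filter.Tendsto d.1.invFun (𝓝[M.interior] x) (𝓝[d.1.source] (d.1.invFun x)) := by
      refine tendsto_nhdsWithin_iff.2
        ⟨(Chart.continuousAt_invFun hx).tendsto.mono_left nhdsWithin_le_nhds, ?_⟩
      filter_upwards [CornersStructure.eventually_posSet d.2.1 hx] with z hz
        using Chart.invFun_mem hz.1
    have hcoef : ∀ z (hz : z ∈ d.1.target),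
        f (d.1.invFun z) = (s z).1 ⟨d.1, d.2.1, d.2.2.1, hz⟩ := by
      intro z hz
      -- The fibre depends on the point, and `z` equals the image of its coordinates only
      -- propositionally.
      have transport : ∀ z' (hz' : z' ∈ d.1.target), z' = z →
          (s z').1 ⟨d.1, d.2.1, d.2.2.1, hz'⟩ = (s z).1 ⟨d.1, d.2.1, d.2.2.1, hz⟩ := by
        rintro z' hz' rfl
        rfl
      rw [hfs _ (Chart.invFun_mem hz)]
      exact transport _ (d.1.map_source' (Chart.invFun_mem hz)) (Chart.toFun_invFun hz)
    -- The coefficient of any such section is continuous and equals `g / mono d` on the interior, so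
    -- its value at `x` is forced to be the limit.
    have hL : Filter.Tendsto (fun z => g z / w.mono d.1 z) (𝓝[M.interior] x)
        (𝓝 (f (d.1.invFun x))) := by
      refine (((hf.continuousOn [] _ (Chart.invFun_mem hx)).tendsto).comp hinv).congr' ?_
      filter_upwards [CornersStructure.eventually_posSet d.2.1 hx, self_mem_nhdsWithin]
        with z hz hzI
      rw [eq_div_iff (w.mono_pos hz).ne', ← hres z hzI ⟨d.1, d.2.1, d.2.2.1, hz.1⟩,
        ← hcoef z hz.1]
      rfl
    have hd : (s x).1 d = w.extensionCoeff g x d := by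
      rw [huniq x d _ hL, hcoef x hx]
      rfl
    -- A vector of the fibre is determined by its coefficient in the single frame `d`.
    refine Subtype.ext (funext fun c => ?_)
    change (s x).1 c = w.extensionCoeff g x c
    rw [(s x).2 c d, hd]
    exact (hfib x c d).symm
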